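/- Let $M=\Gamma\backslash\mathbb H^3$ be a complete hyperbolic three-manifold, where $\Gamma$ is a group of isometries of $\mathbb H^3$ acting freely and properly discontinuously (for example, a quasi-Fuchsian manifold). Let $S$ be a nonempty closed smooth surface, $f:S\to M$ a smooth immersion with a smooth unit normal field $\nu$ along it (for example, the inclusion of a two-sided incompressible surface), and suppose that the principal curvatures of $f$ (the eigenvalues of the shape operator $g^{-1}h$, $h_{ij}=\langle\overline\nabla_{e_i}\nu,e_j\rangle$) all lie in $(-1,1)$. For $r\in\mathbb R$ let $S(r)$ be the parallel surface $x\mapsto \exp_{f(x)}(r\nu(x))$, with the unit normal given by the velocity at time $r$ of the geodesic $t\mapsto\exp_{f(x)}(t\nu(x))$. Let $d\mu(r)$, $|S(r)|$ and $H(\cdot,r)$ be the area measure and the total area of the induced metric on $S$, and the mean curvature (the sum of the principal curvatures) of $S(r)$. Let $h(S(r))=\frac1{|S(r)|}\int_S H(\cdot,r)\,d\mu(r)$ be the average mean curvature. Then for every $r$ the surface $S(r)$ is a smoothly immersed surface of finite area with integrable mean curvature; there is exactly one $r_0\in\mathbb R$ with $h(S(r_0))=0$; and $|S(r_0)|<|S(r)|$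 for every $r\neq r_0$. Moreover, if $\lambda_1,\lambda_2$ are the principal curvatures of $S(r_0)$, then for all $r$ $$|S(r)|=\int_S\bigl(\cosh^2(r-r_0)+\lambda_1\lambda_2\sinh^2(r-r_0)\bigr)\,d\mu(r_0),$$ and this is strictly increasing in $|r-r_0|$. -/

import Mathlib

open scoped Manifold ContDiff
open MeasureTheory

noncomputable section

namespace Hyp

/-! Hyperbolic space in the hyperboloid model, and hyperbolic manifolds as its quotients. -/

/-- The vector space `ℝ⁴` underlying Minkowski space `ℝ^{3,1}`. -/
abbrev V : Type := Fin 4 → ℝ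

/-- The coordinate plane. -/
abbrev E2 : Type := EuclideanSpace ℝ (Fin 2)

/-- The Lorentzian inner product `-x₀y₀ + x₁y₁ + x₂y₂ + x₃y₃`. -/
def mink (x y : V) : ℝ := -(x 0 * y 0) + x 1 * y 1 + x 2 * y 2 + x 3 * y 3

/-- Hyperbolic space `ℍ³`, the upper sheet of the hyperboloid. Its tangent space at `x` is the
Lorentz-orthogonal complement of `x`, and its Riemannian metric is the restriction of `mink`. -/
def H3 : Set V := {x | mink x x = -1 ∧ 0 < x 0}

/-- The unit tangent bundle `T¹ℍ³`, as the set of pairs (point, unit tangent vector). -/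
def T1H3 : Set (V × V) := {z | z.1 ∈ H3 ∧ mink z.1 z.2 = 0 ∧ mink z.2 z.2 = 1}

/-- The isometry group of `ℍ³`: the linear maps that preserve `mink` and the upper sheet. -/
def IsomH3 : Subgroup (V ≃ₗ[ℝ] V) where
  carrier := {A | (∀ x y, mink (A x) (A y) = mink x y) ∧ ∀ x, A x ∈ H3 ↔ x ∈ H3}
  one_mem' := ⟨fun _ _ => rfl, fun _ => Iff.rfl⟩
  mul_mem' := by
    intro A B hA hB
    exact ⟨fun x y => (hA.1 _ _).trans (hB.1 x y), fun x => (hA.2 _).trans (hB.2 x)⟩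
  inv_mem' := by
    intro A hA
    refine ⟨fun x y => ?_, fun x => ?_⟩
    · have h := hA.1 (A.symm x) (A.symm y)
      rw [A.apply_symm_apply, A.apply_symm_apply] at h
      exact h.symm
    · have h := hA.2 (A.symm x)
      rw [A.apply_symm_apply] at h
      exact h.symm

instance : MulAction IsomH3 H3 where
  smul A x := ⟨A.1 x.1, (A.2.2 x.1).2 x.2⟩
  one_smul _ := rfl
  mul_smul _ _ _ := rfl

/-- Isometries act on unit tangent vectors through their differentials. -/
instance : MulAction IsomH3 T1H3 where
  smul A z := ⟨(A.1 z.1.1, A.1 z.1.2), (A.2.2 _).2 z.2.1, (A.2.1 _ _).trans z.2.2.1,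
    (A.2.1 _ _).trans z.2.2.2⟩
  one_smul _ := rfl
  mul_smul _ _ _ := rfl

/-- `Γ` acts freely and properly discontinuously on `ℍ³`, so that `Γ \ ℍ³` is a complete
hyperbolic three-manifold without boundary. -/
structure IsManifoldGroup (Γ : Subgroup IsomH3) : Prop where
  properlyDiscontinuous : ProperlyDiscontinuousSMul Γ H3
  free : ∀ (γ : Γ) (x : H3), γ • x = x → γ = 1

/-- The hyperbolic manifold `M = Γ \ ℍ³`. -/
abbrev Mfd (Γ : Subgroup IsomH3) : Type := MulAction.orbitRel.Quotient Γ H3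

/-- The unit tangent bundle `T¹M = Γ \ T¹ℍ³`. -/
abbrev T1Mfd (Γ : Subgroup IsomH3) : Type := MulAction.orbitRel.Quotient Γ T1H3

/-- The bundle projection `T¹M → M`. -/
def footpoint (Γ : Subgroup IsomH3) : T1Mfd Γ → Mfd Γ :=
  Quotient.map (fun z => (⟨z.1.1, z.2.1⟩ : H3)) (by
    rintro _ b ⟨γ, rfl⟩
    exact ⟨γ, rfl⟩)

theorem flow_mem (r : ℝ) {z : V × V} (hz : z ∈ T1H3) :
    (Real.cosh r • z.1 + Real.sinh r • z.2, Real.sinh r • z.1 + Real.cosh r • z.2) ∈ T1H3 := by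
  obtain ⟨x, v⟩ := z
  obtain ⟨⟨h1, h0⟩, h2, h3⟩ := hz
  have hcs := Real.cosh_sq r
  simp only [mink] at h1 h2 h3 h0
  refine ⟨⟨?_, ?_⟩, ?_, ?_⟩
  · simp only [mink, Pi.add_apply, Pi.smul_apply, smul_eq_mul]
    linear_combination (Real.cosh r) ^ 2 * h1 + 2 * Real.cosh r * Real.sinh r * h2
      + (Real.sinh r) ^ 2 * h3 - hcs
  · simp only [Pi.add_apply, Pi.smul_apply, smul_eq_mul]
    have hv : v 0 ^ 2 < x 0 ^ 2 := by
      have h5 : (x 0 * v 0) ^ 2 ≤ (x 0 ^ 2 - 1) * (v 0 ^ 2 + 1) := by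
        have e1 : x 0 * v 0 = x 1 * v 1 + x 2 * v 2 + x 3 * v 3 := by linarith
        have e2 : x 0 ^ 2 - 1 = x 1 ^ 2 + x 2 ^ 2 + x 3 ^ 2 := by linarith
        have e3 : v 0 ^ 2 + 1 = v 1 ^ 2 + v 2 ^ 2 + v 3 ^ 2 := by linarith
        rw [e1, e2, e3]
        nlinarith [sq_nonneg (x 1 * v 2 - x 2 * v 1), sq_nonneg (x 1 * v 3 - x 3 * v 1),
          sq_nonneg (x 2 * v 3 - x 3 * v 2)]
      nlinarith
    have hv' := abs_lt_of_sq_lt_sq hv h0.le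
    have hc := Real.cosh_pos r
    have hs : |Real.sinh r| ≤ Real.cosh r := abs_le_of_sq_le_sq (by linarith) hc.le
    have h4 : |Real.sinh r * v 0| < Real.cosh r * x 0 := by
      rw [abs_mul]
      calc |Real.sinh r| * |v 0| ≤ Real.cosh r * |v 0| := by gcongr
        _ < Real.cosh r * x 0 := by gcongr
    linarith [(abs_lt.1 h4).1]
  · simp only [mink, Pi.add_apply, Pi.smul_apply, smul_eq_mul]
    linear_combination (Real.cosh r * Real.sinh r) * (h1 + h3)
      + ((Real.cosh r) ^ 2 + (Real.sinh r) ^ 2) * h2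
  · simp only [mink, Pi.add_apply, Pi.smul_apply, smul_eq_mul]
    linear_combination (Real.sinh r) ^ 2 * h1 + 2 * Real.cosh r * Real.sinh r * h2
      + (Real.cosh r) ^ 2 * h3 + hcs

/-- The geodesic flow on `T¹M`: the geodesic of `ℍ³` with initial point `x` and initial unit
velocity `v` is `r ↦ cosh r x + sinh r v`, with velocity `sinh r x + cosh r v` at time `r`. -/
def geodesicFlow (Γ : Subgroup IsomH3) (r : ℝ) : T1Mfd Γ → T1Mfd Γ :=
  Quotient.map (fun z => (⟨_, flow_mem r z.2⟩ : T1H3)) (by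
    rintro _ b ⟨γ, rfl⟩
    refine ⟨γ, Subtype.ext (Prod.ext ?_ ?_)⟩
    · change γ.1.1 _ = _ • γ.1.1 _ + _ • γ.1.1 _
      simp
    · change γ.1.1 _ = _ • γ.1.1 _ + _ • γ.1.1 _
      simp)

/-- The exponential map of `M` at the footpoint of the unit tangent vector `w`, evaluated at the
tangent vector `r w`. -/
def expMap (Γ : Subgroup IsomH3) (r : ℝ) (w : T1Mfd Γ) : Mfd Γ := footpoint Γ (geodesicFlow Γ r w)

/-! Two-sided immersed surfaces `f : S → M` with unit normal field `ν : S → T¹M`. -/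

section Surface

variable {Γ : Subgroup IsomH3} {S : Type*} [TopologicalSpace S] [ChartedSpace E2 S]

/-- The derivative at `q` of `F`, expressed in the coordinates of the chart around `c`; its values
on the standard basis are the partial derivatives of `F`. -/
def coordDeriv (F : S → V) (c q : S) : E2 →L[ℝ] V :=
  fderiv ℝ (F ∘ (chartAt E2 c).symm) (chartAt E2 c q)

/-- `(F, n)` is a smooth lift of `ν` to `T¹ℍ³` over the open set `U`. -/
structure IsLocalLift (ν : S → T1Mfd Γ) (U : Set S) (F n : S → V) : Prop where
  isOpen : IsOpen U
  smooth_point : ContMDiffOn (𝓡 2) 𝓘(ℝ, V) ∞ F U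
  smooth_normal : ContMDiffOn (𝓡 2) 𝓘(ℝ, V) ∞ n U
  lifts : ∀ q ∈ U, ∃ h : (F q, n q) ∈ T1H3, (Quotient.mk _ (⟨(F q, n q), h⟩ : T1H3) : T1Mfd Γ) = ν q

/-- `f : S → M` is a smooth immersion and `ν` is a smooth unit normal field along `f`. -/
structure IsImmersedSurface (f : S → Mfd Γ) (ν : S → T1Mfd Γ) : Prop where
  footpoint_eq : ∀ p, footpoint Γ (ν p) = f p
  exists_lift : ∀ p, ∃ (U : Set S) (F n : S → V), p ∈ U ∧ IsLocalLift ν U F n ∧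
    ∀ q ∈ U, Function.Injective (coordDeriv F q q) ∧ ∀ u, mink (coordDeriv F q q u) (n q) = 0

/-- A choice of a local lift of `ν` around `p`. Two lifts differ by an element of `Γ` near `p`, so
that the quantities computed from it below do not depend on the choice. -/
def liftAt (ν : S → T1Mfd Γ) (p : S) : (S → V) × (S → V) :=
  Classical.epsilon fun L => ∃ U, p ∈ U ∧ IsLocalLift ν U L.1 L.2

/-- The coordinate vectors of the plane. -/
def e (i : Fin 2) : E2 := EuclideanSpace.single i 1

/-- The induced metric `g_ij` at `q`, in the coordinates of the chart around `c`. -/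
def firstForm (ν : S → T1Mfd Γ) (c q : S) : Matrix (Fin 2) (Fin 2) ℝ :=
  Matrix.of fun i j =>
    mink (coordDeriv (liftAt ν q).1 c q (e i)) (coordDeriv (liftAt ν q).1 c q (e j))

/-- The second fundamental form `h_ij = ⟨∇_{e_i} ν, e_j⟩` at `q`, in the coordinates of the chart
around `c`. The Levi-Civita connection of `ℍ³` is the tangential part of the derivative in `ℝ⁴`,
and the tangential projection does not change the inner product with a tangent vector. -/
def secondForm (ν : S → T1Mfd Γ) (c q : S) : Matrix (Fin 2) (Fin 2) ℝ :=
  Matrix.of fun i j =>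
    mink (coordDeriv (liftAt ν q).2 c q (e i)) (coordDeriv (liftAt ν q).1 c q (e j))

/-- The matrix `g⁻¹h` of the shape operator at `p`. -/
def shape (ν : S → T1Mfd Γ) (p : S) : Matrix (Fin 2) (Fin 2) ℝ :=
  (firstForm ν p p)⁻¹ * secondForm ν p p

/-- The principal curvatures at `p`: the eigenvalues of the shape operator with multiplicity. -/
def principalCurvatures (ν : S → T1Mfd Γ) (p : S) : Multiset ℝ := (shape ν p).charpoly.roots

/-- The mean curvature `H = g^{ij} h_ij` at `p` (the sum of the principal curvatures). -/
def meanCurvature (ν : S → T1Mfd Γ) (p : S) : ℝ := (shape ν p).trace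

/-- All principal curvatures lie in `(-1, 1)`. -/
def HasSmallCurvatures (ν : S → T1Mfd Γ) : Prop :=
  ∀ p, ∀ k ∈ principalCurvatures ν p, -1 < k ∧ k < 1

/-- The parallel surface `S(r)`, as the map `p ↦ exp_{f(p)} (r ν(p))`. -/
def parallelMap (ν : S → T1Mfd Γ) (r : ℝ) : S → Mfd Γ := fun p => expMap Γ r (ν p)

/-- The unit normal field of `S(r)`: the velocities at time `r` of the normal geodesics of `S`. -/
def parallelNormal (ν : S → T1Mfd Γ) (r : ℝ) : S → T1Mfd Γ := fun p => geodesicFlow Γ r (ν p)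

/-! The area measure. -/

theorem exists_chartPartition (S : Type*) [TopologicalSpace S] [ChartedSpace E2 S]
    [CompactSpace S] [T2Space S] : ∃ ρ : PartitionOfUnity S S Set.univ,
      ρ.IsSubordinate fun c => (chartAt E2 c).source :=
  PartitionOfUnity.exists_isSubordinate isClosed_univ _ (fun c => (chartAt E2 c).open_source)
    fun p _ => Set.mem_iUnion.2 ⟨p, mem_chart_source E2 p⟩

/-- A partition of unity subordinate to the charts `chartAt E2 c`, `c ∈ S`. -/
def chartPartition (S : Type*) [TopologicalSpace S] [ChartedSpace E2 S]
    [CompactSpace S] [T2Space S] : PartitionOfUnity S S Set.univ :=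
  Classical.choose (exists_chartPartition S)

variable [MeasurableSpace S]

/-- The area measure `√(det g_ij) dx¹dx²` of the induced metric on the domain of the chart
around `c`. -/
def chartArea (ν : S → T1Mfd Γ) (c : S) : Measure S :=
  Measure.map (chartAt E2 c).symm
    ((volume.restrict (chartAt E2 c).target).withDensity fun x =>
      ENNReal.ofReal (Real.sqrt (firstForm ν c ((chartAt E2 c).symm x)).det))

variable [CompactSpace S] [T2Space S]

/-- The area measure of the induced metric, glued from the charts with a partition of unity. -/
def areaMeasure (ν : S → T1Mfd Γ) : Measure S :=
  Measure.sum fun c => (chartArea ν c).withDensity fun p => ENNReal.ofReal (chartPartition S c p)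

/-- The area of the surface with the induced metric. -/
def area (ν : S → T1Mfd Γ) : ENNReal := areaMeasure ν Set.univ

/-- The average mean curvature `(∫ H dμ) / area`. -/
def averageMeanCurvature (ν : S → T1Mfd Γ) : ℝ := ⨍ p, meanCurvature ν p ∂(areaMeasure ν)

end Surface

end Hyp

end

/-!
In the hyperboloid model a local lift `(F, n)` of the surface and its unit normal moves under the
normal flow to `(cosh r F + sinh r n, sinh r F + cosh r n)`, so the parallel surfaces are linear
combinations of two fixed maps. The Weingarten equation `dn = dF ∘ A` (`IsTangentFrame.weingarten`)
then shows that the derivative of the parallel surface is `dF ∘ (cosh r + sinh r A)` and that its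
shape operator is `(cosh r + sinh r A)⁻¹ (sinh r + cosh r A)`. When the eigenvalues of `A` lie in
`(-1, 1)`, the factor `cosh r + sinh r A` is invertible with positive determinant
`J = cosh² r + H cosh r sinh r + K sinh² r`, where `H = tr A` and `K = det A`. Hence the parallel
surfaces are immersed with principal curvatures again in `(-1, 1)`
(`IsImmersedSurface.parallel`, `IsImmersedSurface.smallCurvatures_parallel`), and their area
measures are `J` times the area measure `μ` of `S` (`IsImmersedSurface.areaMeasure_parallel`).

The total mean curvature at distance `r` is the integral of `∂J/∂r`, that is
`a sinh 2r + b cosh 2r` with `a = ∫ (1 + K) dμ` and `b = ∫ H dμ`. Since `|H| < 1 + K` pointwise,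
`|b| < a`, and this function has exactly one zero `r₀`. Starting the flow at `S(r₀)` instead, the
term with `H` integrates to zero and the area at distance `s` is
`∫ (cosh² s + K sinh² s) = area + sinh² s ∫ (1 + K)`, which increases strictly with `|s|`.

The fundamental forms are defined through a chosen lift at each point and through charts. Proper
discontinuity and freeness of the action make two lifts differ locally by one isometry
(`IsLocalLift.eventually_eq_smul`), so any smooth lift computes the forms near a point
(`forms_eq_gram`); `H` and `K` are unchanged by changes of charts
(`IsImmersedSurface.chartShape_trace_det`), and are therefore continuous on the compact surface.
-/

namespace Hyp

open Topology

/-! ### The Lorentzian product -/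

theorem mink_comm (x y : V) : mink x y = mink y x := by simp only [mink]; ring

theorem mink_add_left (x y z : V) : mink (x + y) z = mink x z + mink y z := by
  simp only [mink, Pi.add_apply]; ring

theorem mink_smul_left (a : ℝ) (x z : V) : mink (a • x) z = a * mink x z := by
  simp only [mink, Pi.smul_apply, smul_eq_mul]; ring

theorem mink_add_right (x y z : V) : mink x (y + z) = mink x y + mink x z := by
  simp only [mink, Pi.add_apply]; ring

theorem mink_smul_right (a : ℝ) (x z : V) : mink x (a • z) = a * mink x z := by
  simp only [mink, Pi.smul_apply, smul_eq_mul]; ring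

theorem mink_zero_right (x : V) : mink x 0 = 0 := by simp [mink]

/-- The orthogonal complement of a point of `ℍ³` is spacelike, by the Cauchy–Schwarz inequality. -/
theorem mink_self_pos {x v : V} (hx : x ∈ H3) (hv : mink v x = 0) (h0 : v ≠ 0) :
    0 < mink v v := by
  obtain ⟨h1, hx0⟩ := hx
  simp only [mink] at *
  have h5 : (x 0 * v 0) ^ 2 ≤ (x 0 ^ 2 - 1) * (v 1 ^ 2 + v 2 ^ 2 + v 3 ^ 2) := by
    have e1 : x 0 * v 0 = x 1 * v 1 + x 2 * v 2 + x 3 * v 3 := by linarith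
    have e2 : x 0 ^ 2 - 1 = x 1 ^ 2 + x 2 ^ 2 + x 3 ^ 2 := by linarith
    rw [e1, e2]
    nlinarith [sq_nonneg (x 1 * v 2 - x 2 * v 1), sq_nonneg (x 1 * v 3 - x 3 * v 1),
      sq_nonneg (x 2 * v 3 - x 3 * v 2)]
  have hpos : 0 < v 1 ^ 2 + v 2 ^ 2 + v 3 ^ 2 := by
    by_contra hcon
    have z1 : v 1 = 0 := by nlinarith [sq_nonneg (v 1), sq_nonneg (v 2), sq_nonneg (v 3)]
    have z2 : v 2 = 0 := by nlinarith [sq_nonneg (v 1), sq_nonneg (v 2), sq_nonneg (v 3)]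
    have z3 : v 3 = 0 := by nlinarith [sq_nonneg (v 1), sq_nonneg (v 2), sq_nonneg (v 3)]
    have z0 : v 0 = 0 := by
      simp only [z1, z2, z3] at hv
      have : v 0 * x 0 = 0 := by linarith
      exact (mul_eq_zero.1 this).resolve_right hx0.ne'
    apply h0
    ext i
    fin_cases i <;> simp [z0, z1, z2, z3]
  have hx2 : 0 < x 0 ^ 2 := by positivity
  by_contra hcon
  nlinarith

/-! ### The linear algebra of the fundamental forms -/

/-- The matrix `⟨L eᵢ, N eⱼ⟩` of Lorentzian products of coordinate derivatives. With `L = N = dF`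
this is the first fundamental form, with `L = dn` and `N = dF` the second one. -/
noncomputable def gram (L N : E2 →L[ℝ] V) : Matrix (Fin 2) (Fin 2) ℝ :=
  Matrix.of fun i j => mink (L (e i)) (N (e j))

/-- The first-order data of an immersed surface at a point: the position `x`, the unit normal `n`,
and their derivatives `L` and `N` in a coordinate system. -/
structure IsTangentFrame (x n : V) (L N : E2 →L[ℝ] V) : Prop where
  mem : (x, n) ∈ T1H3
  injective : Function.Injective L
  deriv_point : ∀ u, mink (L u) x = 0
  deriv_normal : ∀ u, mink (L u) n = 0
  normalDeriv_point : ∀ u, mink (N u) x = 0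
  normalDeriv_normal : ∀ u, mink (N u) n = 0
  symm : ∀ u v, mink (N u) (L v) = mink (N v) (L u)

theorem eq_coord_add (u : E2) : u = u 0 • e 0 + u 1 • e 1 := by
  ext i; fin_cases i <;> simp [e]

theorem gram_apply (L N : E2 →L[ℝ] V) (i j : Fin 2) : gram L N i j = mink (L (e i)) (N (e j)) :=
  rfl

theorem gram_comb (L N : E2 →L[ℝ] V) (a b c d : ℝ) :
    gram (a • L + b • N) (c • L + d • N) =
      (a * c) • gram L L + (a * d) • gram L N + (b * c) • gram N L + (b * d) • gram N N := by
  ext i j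
  simp only [gram, Matrix.of_apply, Matrix.add_apply, Matrix.smul_apply, add_apply,
    smul_apply, mink_add_left, mink_add_right, mink_smul_left,
    mink_smul_right, smul_eq_mul]
  ring

theorem gram_isometry {A : V ≃ₗ[ℝ] V} (hA : ∀ x y, mink (A x) (A y) = mink x y)
    {L N L' N' : E2 →L[ℝ] V} (hL : ∀ u, L' u = A (L u)) (hN : ∀ u, N' u = A (N u)) :
    gram L' N' = gram L N := by
  ext i j; simp [gram, hL, hN, hA]

/-- The matrix of an endomorphism of the coordinate plane in the standard basis. -/
noncomputable def planeMatrix (T : E2 →L[ℝ] E2) : Matrix (Fin 2) (Fin 2) ℝ :=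
  Matrix.of fun i j => T (e j) i

theorem gram_comp (L N : E2 →L[ℝ] V) (T : E2 →L[ℝ] E2) :
    gram (L.comp T) (N.comp T) = (planeMatrix T).transpose * gram L N * planeMatrix T := by
  ext i j
  have hi := eq_coord_add (T (e i))
  have hj := eq_coord_add (T (e j))
  simp only [gram, Matrix.of_apply, ContinuousLinearMap.comp_apply, Matrix.mul_apply,
    Fin.sum_univ_two, Matrix.transpose_apply, planeMatrix]
  rw [hi, hj]
  simp only [map_add, map_smul, mink_add_left, mink_add_right, mink_smul_left, mink_smul_right]
  simp [e]
  ring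

/-- A change of coordinates conjugates `g⁻¹h`, so its trace and determinant are invariant. -/
theorem trace_det_conj {g h T : Matrix (Fin 2) (Fin 2) ℝ}
    (hdet : (T.transpose * g * T).det ≠ 0) :
    ((T.transpose * g * T)⁻¹ * (T.transpose * h * T)).trace = (g⁻¹ * h).trace ∧
    ((T.transpose * g * T)⁻¹ * (T.transpose * h * T)).det = (g⁻¹ * h).det := by
  have hT : IsUnit T.det := by
    rw [isUnit_iff_ne_zero]; rintro h0; simp [h0] at hdet
  have hT' : IsUnit T.transpose.det := by rwa [Matrix.det_transpose]
  have key : (T.transpose * g * T)⁻¹ * (T.transpose * h * T) = T⁻¹ * (g⁻¹ * h) * T := by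
    rw [Matrix.mul_inv_rev, Matrix.mul_inv_rev]
    calc _ = T⁻¹ * (g⁻¹ * ((T.transpose⁻¹ * T.transpose) * h)) * T := by
            simp only [Matrix.mul_assoc]
      _ = _ := by rw [Matrix.nonsing_inv_mul _ hT', Matrix.one_mul]
  rw [key]
  constructor
  · rw [Matrix.trace_mul_comm, ← Matrix.mul_assoc, Matrix.mul_nonsing_inv _ hT, Matrix.one_mul]
  · rw [Matrix.det_mul, Matrix.det_mul, mul_right_comm, ← Matrix.det_mul,
      Matrix.nonsing_inv_mul _ hT, Matrix.det_one, one_mul]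

namespace IsTangentFrame

variable {x n : V} {L N : E2 →L[ℝ] V}

theorem mink_deriv_self_pos (h : IsTangentFrame x n L N) {u : E2} (hu : u ≠ 0) :
    0 < mink (L u) (L u) :=
  mink_self_pos h.mem.1 (h.deriv_point u) fun h0 => hu (h.injective (by rw [h0, map_zero]))

theorem gram_zero_zero_pos (h : IsTangentFrame x n L N) : 0 < gram L L 0 0 :=
  h.mink_deriv_self_pos fun h0 => by simpa [e] using congrArg (fun u : E2 => u 0) h0

theorem gram_symm (h : IsTangentFrame x n L N) : gram N L = gram L N := by
  ext i j
  exact (h.symm _ _).trans (mink_comm _ _)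

theorem det_gram_pos (h : IsTangentFrame x n L N) : 0 < (gram L L).det := by
  have h0 := h.gram_zero_zero_pos
  -- Evaluate the form on the vector `-g₀₁ e₀ + g₀₀ e₁`, where it is `g₀₀ det g`.
  have h1 : 0 < mink (L (-gram L L 0 1 • e 0 + gram L L 0 0 • e 1))
      (L (-gram L L 0 1 • e 0 + gram L L 0 0 • e 1)) := by
    refine h.mink_deriv_self_pos fun h2 => h0.ne' ?_
    simpa [e] using congrArg (fun u : E2 => u 1) h2
  have h3 : gram L L 1 0 = gram L L 0 1 := mink_comm _ _
  rw [Matrix.det_fin_two]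
  simp only [map_add, map_smul, mink_add_left, mink_add_right, mink_smul_left,
    mink_smul_right] at h1
  simp only [← gram_apply] at h1
  rw [h3] at *
  by_contra hcon
  nlinarith

/-- The tangent plane and the vectors `x`, `n` span the Minkowski space, so a vector orthogonal to
all of them vanishes. -/
theorem eq_zero_of_orthogonal (h : IsTangentFrame x n L N) {w : V} (hx : mink w x = 0)
    (hn : mink w n = 0) (h0 : mink w (L (e 0)) = 0) (h1 : mink w (L (e 1)) = 0) : w = 0 := by
  have hdet := h.det_gram_pos
  obtain ⟨⟨hxx, hx0⟩, hxn, hnn⟩ := h.mem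
  have hli : LinearIndependent ℝ ![x, n, L (e 0), L (e 1)] := by
    rw [Fintype.linearIndependent_iff]
    intro a ha
    simp only [Fin.sum_univ_four, Matrix.cons_val] at ha
    have pair : ∀ y, a 0 * mink x y + a 1 * mink n y + a 2 * mink (L (e 0)) y
        + a 3 * mink (L (e 1)) y = 0 := by
      intro y
      have := congrArg (fun z => mink z y) ha
      simpa only [mink_add_left, mink_smul_left, mink_comm 0 y, mink_zero_right] using this
    have px := pair x
    have pn := pair n
    have p0 := pair (L (e 0))
    have p1 := pair (L (e 1))
    simp only [h.deriv_point, h.deriv_normal, mink_comm x (L _), mink_comm n (L _), hxx, hxn, hnn,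
      mink_comm n x] at px pn p0 p1
    rw [Matrix.det_fin_two] at hdet
    change 0 < mink _ _ * mink _ _ - mink _ _ * mink _ _ at hdet
    set E := mink (L (e 0)) (L (e 0))
    set G := mink (L (e 1)) (L (e 1))
    set F := mink (L (e 0)) (L (e 1))
    rw [mink_comm (L (e 1)) (L (e 0))] at hdet p0
    have a2 : a 2 = 0 := by
      have : a 2 * (E * G - F * F) = 0 := by linear_combination G * p0 - F * p1
      exact (mul_eq_zero.1 this).resolve_right hdet.ne'
    have a3 : a 3 = 0 := by
      have : a 3 * (E * G - F * F) = 0 := by linear_combination E * p1 - F * p0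
      exact (mul_eq_zero.1 this).resolve_right hdet.ne'
    intro i
    fin_cases i <;> simp <;> linarith
  have hspan := hli.span_eq_top_of_card_eq_finrank (by simp)
  have hw : w ∈ Submodule.span ℝ (Set.range ![x, n, L (e 0), L (e 1)]) := hspan ▸ trivial
  have hall : ∀ y ∈ Submodule.span ℝ (Set.range ![x, n, L (e 0), L (e 1)]), mink w y = 0 := by
    intro y hy
    induction hy using Submodule.span_induction with
    | mem y hy =>
      obtain ⟨i, rfl⟩ := hy
      fin_cases i
      exacts [hx, hn, h0, h1]
    | zero => exact mink_zero_right w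
    | add y z _ _ hy hz => rw [mink_add_right, hy, hz, add_zero]
    | smul a y _ hy => rw [mink_smul_right, hy, mul_zero]
  by_contra hne
  exact (mink_self_pos h.mem.1 hx hne).ne' (hall w hw)

/-- The Weingarten equation: the derivative of the normal is the derivative of the position
composed with the shape operator `g⁻¹h`. -/
theorem weingarten (h : IsTangentFrame x n L N) (i : Fin 2) :
    N (e i) = ((gram L L)⁻¹ * gram N L) 0 i • L (e 0) +
      ((gram L L)⁻¹ * gram N L) 1 i • L (e 1) := by
  set A := (gram L L)⁻¹ * gram N L with hA
  have hgA : gram L L * A = gram L N := by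
    rw [hA, ← Matrix.mul_assoc, Matrix.mul_nonsing_inv _ h.det_gram_pos.ne'.isUnit, Matrix.one_mul,
      h.gram_symm]
  have hg : ∀ j, mink (L (e 0)) (L (e j)) * A 0 i + mink (L (e 1)) (L (e j)) * A 1 i
      = mink (L (e j)) (N (e i)) := by
    intro j
    have := congrFun (congrFun hgA j) i
    simp only [Matrix.mul_apply, Fin.sum_univ_two] at this
    rw [mink_comm (L (e 0)), mink_comm (L (e 1))]
    exact this
  rw [← sub_eq_zero]
  have e1 : ∀ y, mink (N (e i) - (A 0 i • L (e 0) + A 1 i • L (e 1))) y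
      = mink (N (e i)) y - (A 0 i * mink (L (e 0)) y + A 1 i * mink (L (e 1)) y) := by
    intro y
    simp only [mink, Pi.sub_apply, Pi.add_apply, Pi.smul_apply, smul_eq_mul]; ring
  refine h.eq_zero_of_orthogonal ?_ ?_ ?_ ?_ <;> rw [e1]
  · simp [h.deriv_point, h.normalDeriv_point]
  · simp [h.deriv_normal, h.normalDeriv_normal]
  · linarith [hg 0, mink_comm (L (e 0)) (N (e i))]
  · linarith [hg 1, mink_comm (L (e 1)) (N (e i))]

/-- The third fundamental form is `h g⁻¹ h`. -/
theorem gram_normal_normal (h : IsTangentFrame x n L N) :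
    gram N N = gram N L * ((gram L L)⁻¹ * gram N L) := by
  ext i j
  simp only [Matrix.mul_apply (M := gram N L), Fin.sum_univ_two]
  change mink (N (e i)) (N (e j)) = mink _ _ * _ + mink _ _ * _
  rw [h.weingarten j, mink_add_right, mink_smul_right, mink_smul_right]
  ring

theorem mul_shape (h : IsTangentFrame x n L N) :
    gram L L * ((gram L L)⁻¹ * gram N L) = gram N L := by
  rw [← Matrix.mul_assoc, Matrix.mul_nonsing_inv _ h.det_gram_pos.ne'.isUnit, Matrix.one_mul]

/-- The products of two combinations `a dF + b dn` and `c dF + d dn`, in terms of `g` and `g⁻¹h`. -/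
theorem gram_parallel (h : IsTangentFrame x n L N) (a b c d : ℝ) :
    gram (a • L + b • N) (c • L + d • N) = gram L L *
      ((c • 1 + d • ((gram L L)⁻¹ * gram N L)) * (a • 1 + b • ((gram L L)⁻¹ * gram N L))) := by
  rw [gram_comb, h.gram_normal_normal, ← h.gram_symm]
  have hgA := h.mul_shape
  set A := (gram L L)⁻¹ * gram N L
  rw [← hgA]
  simp only [Matrix.mul_add, Matrix.add_mul, Matrix.mul_smul, Matrix.smul_mul, Matrix.mul_one,
    Matrix.one_mul, Matrix.mul_assoc, smul_add, smul_smul]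
  module

/-- The discriminant of the characteristic polynomial of the shape operator is nonnegative: the
shape operator is symmetric with respect to the first fundamental form. -/
theorem discrim_nonneg (h : IsTangentFrame x n L N) :
    0 ≤ ((gram L L)⁻¹ * gram N L).trace ^ 2 - 4 * ((gram L L)⁻¹ * gram N L).det := by
  have hgA := h.mul_shape
  set A := (gram L L)⁻¹ * gram N L
  have hE := h.gram_zero_zero_pos
  have hD := h.det_gram_pos
  have hF : gram L L 1 0 = gram L L 0 1 := mink_comm _ _
  have hs : gram N L 0 1 = gram N L 1 0 := h.symm _ _
  rw [← hgA] at hs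
  simp only [Matrix.mul_apply, Fin.sum_univ_two] at hs
  rw [Matrix.det_fin_two, hF] at hD
  rw [hF] at hs
  rw [Matrix.trace_fin_two, Matrix.det_fin_two]
  generalize gram L L 0 0 = E at *
  generalize gram L L 0 1 = F at *
  generalize gram L L 1 1 = G at *
  generalize A 0 0 = a at *
  generalize A 0 1 = b at *
  generalize A 1 0 = c at *
  generalize A 1 1 = d at *
  -- Symmetry says `E b + F d = F a + G c`; complete the square after multiplying by `E²`.
  have key : E ^ 2 * ((a + d) ^ 2 - 4 * (a * d - b * c))
      = (E * (a - d) + 2 * F * c) ^ 2 + 4 * (E * G - F * F) * c ^ 2 := by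
    have hb : E * b = F * a + G * c - F * d := by linarith
    linear_combination 4 * c * E * hb
  have hpos : 0 ≤ E ^ 2 * ((a + d) ^ 2 - 4 * (a * d - b * c)) := by
    rw [key]; positivity
  exact nonneg_of_mul_nonneg_right hpos (by positivity)

end IsTangentFrame

theorem injective_of_det_gram_ne_zero {L : E2 →L[ℝ] V} (h : (gram L L).det ≠ 0) :
    Function.Injective L := by
  refine (injective_iff_map_eq_zero L).2 fun u hu => ?_
  have h1 : (gram L L).mulVec ![u 0, u 1] = 0 := by
    ext i
    have h2 : mink (L (e i)) (L u) = 0 := by rw [hu, mink_zero_right]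
    rw [eq_coord_add u] at h2
    simp only [map_add, map_smul, mink_add_right, mink_smul_right] at h2
    simp [Matrix.mulVec, dotProduct, Fin.sum_univ_two, gram_apply]
    linarith
  have h2 := Matrix.eq_zero_of_mulVec_eq_zero h h1
  have e0 : u 0 = 0 := congrFun h2 0
  have e1 : u 1 = 0 := congrFun h2 1
  rw [eq_coord_add u, e0, e1]; simp

theorem det_smul_one_add_smul (A : Matrix (Fin 2) (Fin 2) ℝ) (a b : ℝ) :
    (a • 1 + b • A).det = a ^ 2 + A.trace * (a * b) + A.det * b ^ 2 := by
  simp [Matrix.det_fin_two, Matrix.trace_fin_two]; ring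

theorem det_mul_trace_inv_mul (A : Matrix (Fin 2) (Fin 2) ℝ) (a b : ℝ)
    (h : (a • 1 + b • A).det ≠ 0) :
    (a • 1 + b • A).det * ((a • 1 + b • A)⁻¹ * (b • 1 + a • A)).trace =
      2 * (a * b) + A.trace * (a ^ 2 + b ^ 2) + 2 * A.det * (a * b) := by
  rw [Matrix.inv_def, Ring.inverse_eq_inv', Matrix.smul_mul, Matrix.trace_smul, smul_eq_mul,
    mul_inv_cancel_left₀ h]
  simp [Matrix.det_fin_two, Matrix.trace_fin_two, Matrix.adjugate_fin_two, Matrix.vecMul,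
    dotProduct, Fin.sum_univ_two]
  ring

/-- A real `2 × 2` matrix with trace `a + b` and determinant `a b` has eigenvalues `a` and `b`. -/
theorem charpoly_roots_eq {A : Matrix (Fin 2) (Fin 2) ℝ} {a b : ℝ} (ht : A.trace = a + b)
    (hd : A.det = a * b) : A.charpoly.roots = {a, b} := by
  have : A.charpoly = (Polynomial.X - Polynomial.C a) * (Polynomial.X - Polynomial.C b) := by
    rw [Matrix.charpoly_fin_two, ht, hd]; simp only [map_add, map_mul]; ring
  rw [this, Polynomial.roots_mul
    (mul_ne_zero (Polynomial.X_sub_C_ne_zero a) (Polynomial.X_sub_C_ne_zero b)),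
    Polynomial.roots_X_sub_C, Polynomial.roots_X_sub_C]
  rfl

theorem IsTangentFrame.exists_eigenvalues {x n : V} {L N : E2 →L[ℝ] V}
    (h : IsTangentFrame x n L N) : ∃ k : ℝ × ℝ,
      ((gram L L)⁻¹ * gram N L).trace = k.1 + k.2 ∧ ((gram L L)⁻¹ * gram N L).det = k.1 * k.2 := by
  have hd := h.discrim_nonneg
  set t := ((gram L L)⁻¹ * gram N L).trace
  set d := ((gram L L)⁻¹ * gram N L).det
  refine ⟨((t + √(t ^ 2 - 4 * d)) / 2, (t - √(t ^ 2 - 4 * d)) / 2), by ring, ?_⟩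
  linear_combination (1 / 4) * Real.sq_sqrt hd

/-- For principal curvatures in `(-1, 1)` no focal point is met: the factor by which the flow
stretches a principal direction is positive. -/
theorem cosh_add_mul_sinh_pos {k : ℝ} (hk : -1 < k ∧ k < 1) (r : ℝ) :
    0 < Real.cosh r + k * Real.sinh r := by
  rw [Real.cosh_eq, Real.sinh_eq]
  nlinarith [Real.exp_pos r, Real.exp_pos (-r)]

/-- The principal curvature `(sinh r + k cosh r) / (cosh r + k sinh r)` of the parallel surface. -/
theorem parallel_curvature_mem {k : ℝ} (hk : -1 < k ∧ k < 1) (r : ℝ) :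
    -1 < (Real.sinh r + k * Real.cosh r) / (Real.cosh r + k * Real.sinh r) ∧
      (Real.sinh r + k * Real.cosh r) / (Real.cosh r + k * Real.sinh r) < 1 := by
  have hpos := cosh_add_mul_sinh_pos hk r
  rw [lt_div_iff₀ hpos, div_lt_iff₀ hpos]
  rw [Real.cosh_eq, Real.sinh_eq]
  constructor <;> nlinarith [Real.exp_pos r, Real.exp_pos (-r)]

namespace IsTangentFrame

variable {x n : V} {L N : E2 →L[ℝ] V}

theorem parallel (h : IsTangentFrame x n L N) (r : ℝ)
    (hdet : (Real.cosh r • 1 + Real.sinh r • ((gram L L)⁻¹ * gram N L)).det ≠ 0) :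
    IsTangentFrame (Real.cosh r • x + Real.sinh r • n) (Real.sinh r • x + Real.cosh r • n)
      (Real.cosh r • L + Real.sinh r • N) (Real.sinh r • L + Real.cosh r • N) where
  mem := flow_mem r h.mem
  injective := by
    apply injective_of_det_gram_ne_zero
    rw [h.gram_parallel, Matrix.det_mul, Matrix.det_mul]
    exact mul_ne_zero h.det_gram_pos.ne' (mul_ne_zero hdet hdet)
  deriv_point u := by
    simp [mink_add_left, mink_smul_left, mink_add_right, mink_smul_right, h.deriv_point,
      h.deriv_normal, h.normalDeriv_point, h.normalDeriv_normal]
  deriv_normal u := by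
    simp [mink_add_left, mink_smul_left, mink_add_right, mink_smul_right, h.deriv_point,
      h.deriv_normal, h.normalDeriv_point, h.normalDeriv_normal]
  normalDeriv_point u := by
    simp [mink_add_left, mink_smul_left, mink_add_right, mink_smul_right, h.deriv_point,
      h.deriv_normal, h.normalDeriv_point, h.normalDeriv_normal]
  normalDeriv_normal u := by
    simp [mink_add_left, mink_smul_left, mink_add_right, mink_smul_right, h.deriv_point,
      h.deriv_normal, h.normalDeriv_point, h.normalDeriv_normal]
  symm u v := by
    simp only [add_apply, smul_apply, mink_add_left, mink_smul_left, mink_add_right,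
      mink_smul_right]
    rw [mink_comm (L u) (L v), mink_comm (N u) (N v), mink_comm (L u) (N v),
      mink_comm (L v) (N u), h.symm u v]

/-- The shape operator of the parallel surface is `(cosh r + sinh r A)⁻¹ (sinh r + cosh r A)`. -/
theorem shape_parallel (h : IsTangentFrame x n L N) (r : ℝ)
    (hdet : (Real.cosh r • 1 + Real.sinh r • ((gram L L)⁻¹ * gram N L)).det ≠ 0) :
    (gram (Real.cosh r • L + Real.sinh r • N) (Real.cosh r • L + Real.sinh r • N))⁻¹ *
      gram (Real.sinh r • L + Real.cosh r • N) (Real.cosh r • L + Real.sinh r • N) =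
    (Real.cosh r • 1 + Real.sinh r • ((gram L L)⁻¹ * gram N L))⁻¹ *
      (Real.sinh r • 1 + Real.cosh r • ((gram L L)⁻¹ * gram N L)) := by
  rw [h.gram_parallel, h.gram_parallel]
  set M := Real.cosh r • 1 + Real.sinh r • ((gram L L)⁻¹ * gram N L)
  set M' := Real.sinh r • 1 + Real.cosh r • ((gram L L)⁻¹ * gram N L)
  rw [Matrix.mul_inv_rev, Matrix.mul_inv_rev]
  calc _ = M⁻¹ * (M⁻¹ * ((gram L L)⁻¹ * gram L L) * M) * M' := by simp only [Matrix.mul_assoc]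
    _ = _ := by
      rw [Matrix.nonsing_inv_mul _ h.det_gram_pos.ne'.isUnit, Matrix.mul_one,
        Matrix.nonsing_inv_mul _ hdet.isUnit, Matrix.mul_one]

end IsTangentFrame

/-! ### Lifts and coordinate derivatives -/

section Lifts

variable {Γ : Subgroup IsomH3} {S : Type*} [TopologicalSpace S] [ChartedSpace E2 S]

/-- By proper discontinuity and freeness, two lifts of a unit normal field differ near each point
by a single element of `Γ`. -/
theorem IsLocalLift.eventually_eq_smul [LocallyCompactSpace S] (hΓ : IsManifoldGroup Γ)
    {ν : S → T1Mfd Γ} {U U' : Set S}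
    {F n F' n' : S → V} (h : IsLocalLift ν U F n) (h' : IsLocalLift ν U' F' n') {p : S}
    (hp : p ∈ U) (hp' : p ∈ U') :
    ∃ γ : Γ, ∀ᶠ q in 𝓝 p, F' q = γ.1.1 (F q) ∧ n' q = γ.1.1 (n q) := by
  have hex : ∀ q ∈ U ∩ U', ∃ γ : Γ, F' q = γ.1.1 (F q) ∧ n' q = γ.1.1 (n q) := by
    rintro q ⟨hq, hq'⟩
    obtain ⟨hz, e1⟩ := h.lifts q hq
    obtain ⟨hz', e2⟩ := h'.lifts q hq'
    obtain ⟨γ, hγ⟩ := Quotient.exact (e2.trans e1.symm)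
    have := congrArg Subtype.val hγ
    exact ⟨γ, (congrArg Prod.fst this).symm, (congrArg Prod.snd this).symm⟩
  have hmem : ∀ q ∈ U, F q ∈ H3 := fun q hq => (h.lifts q hq).choose.1
  have hmem' : ∀ q ∈ U', F' q ∈ H3 := fun q hq => (h'.lifts q hq).choose.1
  obtain ⟨K, hK, hpK, hKU⟩ := exists_compact_subset (h.isOpen.inter h'.isOpen) ⟨hp, hp'⟩
  have hc : ∀ {G : S → V}, ContinuousOn G K → (∀ q ∈ K, G q ∈ H3) →
      IsCompact ((Subtype.val : H3 → V) ⁻¹' (G '' K)) := by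
    intro G hG hGm
    rw [Topology.IsInducing.subtypeVal.isCompact_preimage_iff]
    · exact hK.image_of_continuousOn hG
    · rintro _ ⟨q, hq, rfl⟩
      exact ⟨⟨_, hGm q hq⟩, rfl⟩
  have hfin := hΓ.properlyDiscontinuous.finite_disjoint_inter_image
    (hc (h.smooth_point.continuousOn.mono fun q hq => (hKU hq).1) fun q hq => hmem q (hKU hq).1)
    (hc (h'.smooth_point.continuousOn.mono fun q hq => (hKU hq).2) fun q hq => hmem' q (hKU hq).2)
  obtain ⟨γ₀, hγ₀⟩ := hex p ⟨hp, hp'⟩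
  refine ⟨γ₀, ?_⟩
  have hFc := h.smooth_point.continuousOn.continuousAt (h.isOpen.mem_nhds hp)
  have hFc' := h'.smooth_point.continuousOn.continuousAt (h'.isOpen.mem_nhds hp')
  -- By freeness, `γ ≠ γ₀` cannot relate the lifts at `p`, hence not near `p`. Only finitely many
  -- `γ` carry points of `F '' K` into `F' '' K`, so one neighbourhood excludes all of them.
  have hne : ∀ γ : Γ, γ ≠ γ₀ → ∀ᶠ q in 𝓝 p, F' q ≠ γ.1.1 (F q) := by
    intro γ hγ
    have hcont : ContinuousAt (fun q => γ.1.1 (F q)) p :=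
      (γ.1.1.toContinuousLinearEquiv.continuous.continuousAt).comp hFc
    refine (hFc'.ne_iff_eventually_ne hcont).1 fun heq => ?_
    apply hγ
    have hfree := hΓ.free (γ₀⁻¹ * γ) ⟨F p, hmem p hp⟩ (by
      rw [mul_smul, inv_smul_eq_iff]
      exact Subtype.ext (heq.symm.trans hγ₀.1))
    exact (inv_mul_eq_one.1 hfree).symm
  have hall := (Filter.eventually_all_finite hfin).2 (fun γ _ =>
    (Filter.eventually_imp_distrib_left (p := γ ≠ γ₀)).2 (hne γ))
  filter_upwards [hall, mem_interior_iff_mem_nhds.1 hpK] with q hq hqK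
  obtain ⟨γ, h1, h2⟩ := hex q (hKU hqK)
  have hγ : γ = γ₀ := by
    by_contra hcon
    refine hq γ ⟨⟨F' q, hmem' q (hKU hqK).2⟩, ⟨⟨F q, hmem q (hKU hqK).1⟩, ⟨q, hqK, rfl⟩, ?_⟩,
      ⟨q, hqK, rfl⟩⟩ hcon h1
    exact Subtype.ext h1.symm
  exact hγ ▸ ⟨h1, h2⟩

theorem coordDeriv_congr {F G : S → V} {c q : S} (hq : q ∈ (chartAt E2 c).source)
    (h : F =ᶠ[𝓝 q] G) : coordDeriv F c q = coordDeriv G c q := by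
  apply Filter.EventuallyEq.fderiv_eq
  have := (chartAt E2 c).tendsto_symm hq
  exact this.eventually h

theorem coordDeriv_linearEquiv (A : V ≃ₗ[ℝ] V) (F : S → V) (c q : S) (u : E2) :
    coordDeriv (fun q => A (F q)) c q u = A (coordDeriv F c q u) := by
  have := A.toContinuousLinearEquiv.comp_fderiv (f := F ∘ (chartAt E2 c).symm)
    (x := chartAt E2 c q)
  exact congrArg (fun T => T u) this

/-- The fundamental forms can be computed with any local lift: the chosen lift `liftAt ν q` differs
from it near `q` by an isometry. -/
theorem forms_eq_gram [LocallyCompactSpace S] (hΓ : IsManifoldGroup Γ) {ν : S → T1Mfd Γ}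
    {U : Set S} {F n : S → V} (h : IsLocalLift ν U F n) {q c : S} (hq : q ∈ U)
    (hc : q ∈ (chartAt E2 c).source) :
    firstForm ν c q = gram (coordDeriv F c q) (coordDeriv F c q) ∧
      secondForm ν c q = gram (coordDeriv n c q) (coordDeriv F c q) := by
  obtain ⟨U', hq', h'⟩ : ∃ U', q ∈ U' ∧ IsLocalLift ν U' (liftAt ν q).1 (liftAt ν q).2 :=
    Classical.epsilon_spec (p := fun L : (S → V) × (S → V) => ∃ U, q ∈ U ∧ IsLocalLift ν U L.1 L.2)
      ⟨(F, n), U, hq, h⟩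
  obtain ⟨γ, hγ⟩ := h.eventually_eq_smul hΓ h' hq hq'
  have hF : ∀ u, coordDeriv (liftAt ν q).1 c q u = γ.1.1 (coordDeriv F c q u) := fun u => by
    rw [← coordDeriv_linearEquiv, coordDeriv_congr hc (hγ.mono fun _ h => h.1)]
  have hn : ∀ u, coordDeriv (liftAt ν q).2 c q u = γ.1.1 (coordDeriv n c q u) := fun u => by
    rw [← coordDeriv_linearEquiv, coordDeriv_congr hc (hγ.mono fun _ h => h.2)]
  exact ⟨gram_isometry γ.1.2.1 hF hF, gram_isometry γ.1.2.1 hn hF⟩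

section Smooth

variable [IsManifold (𝓡 2) ∞ S] {E : Type*} [NormedAddCommGroup E] [NormedSpace ℝ E]

theorem contDiffOn_comp_chart_symm {F : S → E} {U : Set S}
    (hF : ContMDiffOn (𝓡 2) 𝓘(ℝ, E) ∞ F U) (c : S) :
    ContDiffOn ℝ ∞ (F ∘ (chartAt E2 c).symm)
      ((chartAt E2 c).target ∩ (chartAt E2 c).symm ⁻¹' U) := by
  rw [← contMDiffOn_iff_contDiffOn]
  exact hF.comp ((contMDiffOn_chart_symm (I := 𝓡 2) (n := ∞)).mono Set.inter_subset_left)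
    fun x hx => hx.2

theorem contDiffAt_comp_chart_symm {F : S → E} {U : Set S} (hU : IsOpen U)
    (hF : ContMDiffOn (𝓡 2) 𝓘(ℝ, E) ∞ F U) {c q : S} (hq : q ∈ U)
    (hc : q ∈ (chartAt E2 c).source) :
    ContDiffAt ℝ ∞ (F ∘ (chartAt E2 c).symm) (chartAt E2 c q) := by
  refine (contDiffOn_comp_chart_symm hF c).contDiffAt
    (((chartAt E2 c).isOpen_inter_preimage_symm hU).mem_nhds ⟨(chartAt E2 c).map_source hc, ?_⟩)
  simpa [(chartAt E2 c).left_inv hc] using hq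

/-- The derivative at `q` of the transition map from the chart around `c'` to the one around
`c`. -/
noncomputable def transitionDeriv (c c' q : S) : E2 →L[ℝ] E2 :=
  fderiv ℝ (chartAt E2 c ∘ (chartAt E2 c').symm) (chartAt E2 c' q)

theorem coordDeriv_eq_comp {F : S → V} {U : Set S} (hU : IsOpen U)
    (hF : ContMDiffOn (𝓡 2) 𝓘(ℝ, V) ∞ F U) {c c' q : S} (hq : q ∈ U)
    (hc : q ∈ (chartAt E2 c).source) (hc' : q ∈ (chartAt E2 c').source) :
    coordDeriv F c' q = (coordDeriv F c q).comp (transitionDeriv c c' q) := by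
  have h1 : DifferentiableAt ℝ (chartAt E2 c ∘ (chartAt E2 c').symm) (chartAt E2 c' q) :=
    (contDiffAt_comp_chart_symm (chartAt E2 c).open_source
      (contMDiffOn_chart (I := 𝓡 2) (n := ∞)) hc hc').differentiableAt (by simp)
  have hval : (chartAt E2 c ∘ (chartAt E2 c').symm) (chartAt E2 c' q) = chartAt E2 c q := by
    simp [(chartAt E2 c').left_inv hc']
  have h2 : DifferentiableAt ℝ (F ∘ (chartAt E2 c).symm)
      ((chartAt E2 c ∘ (chartAt E2 c').symm) (chartAt E2 c' q)) := by
    rw [hval]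
    exact (contDiffAt_comp_chart_symm hU hF hq hc).differentiableAt (by simp)
  have h3 := fderiv_comp (chartAt E2 c' q) h2 h1
  rw [hval] at h3
  refine Eq.trans (Filter.EventuallyEq.fderiv_eq ?_) h3
  have := ((chartAt E2 c').tendsto_symm hc').eventually
    ((chartAt E2 c).open_source.mem_nhds hc)
  filter_upwards [this] with y hy
  simp [(chartAt E2 c).left_inv hy]

theorem coordDeriv_comb {F n : S → V} {U : Set S} (hU : IsOpen U)
    (hF : ContMDiffOn (𝓡 2) 𝓘(ℝ, V) ∞ F U) (hn : ContMDiffOn (𝓡 2) 𝓘(ℝ, V) ∞ n U) {c q : S}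
    (hq : q ∈ U) (hc : q ∈ (chartAt E2 c).source) (a b : ℝ) :
    coordDeriv (fun q => a • F q + b • n q) c q = a • coordDeriv F c q + b • coordDeriv n c q := by
  have h1 := (contDiffAt_comp_chart_symm hU hF hq hc).differentiableAt (by simp)
  have h2 := (contDiffAt_comp_chart_symm hU hn hq hc).differentiableAt (by simp)
  exact ((h1.hasFDerivAt.const_smul a).add (h2.hasFDerivAt.const_smul b)).fderiv

theorem continuousOn_coordDeriv {F : S → V} {U : Set S} (hU : IsOpen U)
    (hF : ContMDiffOn (𝓡 2) 𝓘(ℝ, V) ∞ F U) (c : S) :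
    ContinuousOn (coordDeriv F c) (U ∩ (chartAt E2 c).source) := by
  have h1 := (contDiffOn_comp_chart_symm hF c).continuousOn_fderiv_of_isOpen
    ((chartAt E2 c).isOpen_inter_preimage_symm hU) (by simp)
  refine h1.comp ((chartAt E2 c).continuousOn.mono Set.inter_subset_right) ?_
  rintro q ⟨hq, hc⟩
  refine ⟨(chartAt E2 c).map_source hc, ?_⟩
  simpa [(chartAt E2 c).left_inv hc] using hq

end Smooth

/-! ### Tangent frames of immersed surfaces -/

theorem mink_fderiv_add_eq_zero {f g : E2 → V} {y : E2} (hf : DifferentiableAt ℝ f y)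
    (hg : DifferentiableAt ℝ g y) {a : ℝ} (h : ∀ᶠ z in 𝓝 y, mink (f z) (g z) = a) (u : E2) :
    mink (fderiv ℝ f y u) (g y) + mink (f y) (fderiv ℝ g y u) = 0 := by
  have hf' := fun i => (hasFDerivAt_pi'.1 hf.hasFDerivAt) i
  have hg' := fun i => (hasFDerivAt_pi'.1 hg.hasFDerivAt) i
  have h1 := ((((hf' 0).mul (hg' 0)).neg.add ((hf' 1).mul (hg' 1))).add
    ((hf' 2).mul (hg' 2))).add ((hf' 3).mul (hg' 3))
  have h2 : HasFDerivAt (fun z => mink (f z) (g z)) (0 : E2 →L[ℝ] ℝ) y :=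
    (hasFDerivAt_const a y).congr_of_eventuallyEq h
  have h3 := congrArg (fun T : E2 →L[ℝ] ℝ => T u) (h1.unique h2)
  simp at h3
  simp only [mink]
  linarith

/-- A lift of an immersed surface has a tangent frame in every chart, although the immersion
conditions refer only to the preferred chart at each point. -/
theorem isTangentFrame_of_lift [IsManifold (𝓡 2) ∞ S] {ν : S → T1Mfd Γ} {U : Set S}
    {F n : S → V} (h : IsLocalLift ν U F n)
    (hU : ∀ q ∈ U, Function.Injective (coordDeriv F q q) ∧
      ∀ u, mink (coordDeriv F q q u) (n q) = 0)
    {q c : S} (hq : q ∈ U) (hc : q ∈ (chartAt E2 c).source) :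
    IsTangentFrame (F q) (n q) (coordDeriv F c q) (coordDeriv n c q) := by
  have hsurj : ∀ q ∈ U, q ∈ (chartAt E2 c).source →
      Function.Surjective (transitionDeriv c q q) := by
    intro q hq hc
    have h1 := (hU q hq).1
    rw [coordDeriv_eq_comp h.isOpen h.smooth_point hq hc (mem_chart_source E2 q)] at h1
    exact LinearMap.injective_iff_surjective.1 (Function.Injective.of_comp h1)
  have htan : ∀ q ∈ U, q ∈ (chartAt E2 c).source → ∀ u, mink (coordDeriv F c q u) (n q) = 0 := by
    intro q hq hc u
    obtain ⟨v, rfl⟩ := hsurj q hq hc u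
    have h1 := (hU q hq).2 v
    rwa [coordDeriv_eq_comp h.isOpen h.smooth_point hq hc (mem_chart_source E2 q)] at h1
  have hmem : ∀ q ∈ U, (F q, n q) ∈ T1H3 := fun q hq => (h.lifts q hq).choose
  have hy : ∀ᶠ y in 𝓝 (chartAt E2 c q), y ∈ (chartAt E2 c).target ∧ (chartAt E2 c).symm y ∈ U :=
    ((chartAt E2 c).isOpen_inter_preimage_symm h.isOpen).mem_nhds
      ⟨(chartAt E2 c).map_source hc, by simpa [(chartAt E2 c).left_inv hc] using hq⟩
  have cF := contDiffAt_comp_chart_symm h.isOpen h.smooth_point hq hc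
  have cn := contDiffAt_comp_chart_symm h.isOpen h.smooth_normal hq hc
  have dF : DifferentiableAt ℝ (F ∘ (chartAt E2 c).symm) (chartAt E2 c q) :=
    cF.differentiableAt (by simp)
  have dn : DifferentiableAt ℝ (n ∘ (chartAt E2 c).symm) (chartAt E2 c q) :=
    cn.differentiableAt (by simp)
  have vF : (F ∘ (chartAt E2 c).symm) (chartAt E2 c q) = F q := by
    simp [(chartAt E2 c).left_inv hc]
  have vn : (n ∘ (chartAt E2 c).symm) (chartAt E2 c q) = n q := by
    simp [(chartAt E2 c).left_inv hc]
  have hFF := mink_fderiv_add_eq_zero dF dF (hy.mono fun y hy => (hmem _ hy.2).1.1)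
  have hFn := mink_fderiv_add_eq_zero dF dn (hy.mono fun y hy => (hmem _ hy.2).2.1)
  have hnn := mink_fderiv_add_eq_zero dn dn (hy.mono fun y hy => (hmem _ hy.2).2.2)
  rw [vF] at hFF
  rw [vF, vn] at hFn
  rw [vn] at hnn
  change ∀ u, mink (coordDeriv F c q u) _ + mink _ (coordDeriv F c q u) = 0 at hFF
  change ∀ u, mink (coordDeriv F c q u) _ + mink _ (coordDeriv n c q u) = 0 at hFn
  change ∀ u, mink (coordDeriv n c q u) _ + mink _ (coordDeriv n c q u) = 0 at hnn
  refine ⟨hmem q hq, ?_, fun u => ?_, htan q hq hc, fun u => ?_, fun u => ?_, ?_⟩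
  · have h1 := (hU q hq).1
    rw [coordDeriv_eq_comp h.isOpen h.smooth_point hq hc (mem_chart_source E2 q)] at h1
    exact Function.Injective.of_comp_right h1 (hsurj q hq hc)
  · linarith [hFF u, mink_comm (F q) (coordDeriv F c q u)]
  · linarith [hFn u, htan q hq hc u, mink_comm (F q) (coordDeriv n c q u)]
  · linarith [hnn u, mink_comm (n q) (coordDeriv n c q u)]
  · -- Differentiate `⟨n, ∂ᵥF⟩ = 0` and use the symmetry of the second derivative of `F`.
    have ddF : DifferentiableAt ℝ (fderiv ℝ (F ∘ (chartAt E2 c).symm)) (chartAt E2 c q) :=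
      (cF.fderiv_right (m := 1) (by
        rw [one_add_one_eq_two]; exact ENat.LEInfty.out)).differentiableAt (by simp)
    have hD : ∀ u v, mink (coordDeriv n c q u) (coordDeriv F c q v) +
        mink (n q) (fderiv ℝ (fderiv ℝ (F ∘ (chartAt E2 c).symm)) (chartAt E2 c q) u v) = 0 := by
      intro u v
      have hv : HasFDerivAt (fun y => fderiv ℝ (F ∘ (chartAt E2 c).symm) y v) _ _ :=
        ddF.hasFDerivAt.clm_apply (hasFDerivAt_const v _)
      have := mink_fderiv_add_eq_zero (a := 0) dn hv.differentiableAt (by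
        filter_upwards [hy] with y hy
        have h1 := htan _ hy.2 ((chartAt E2 c).map_target hy.1) v
        rw [coordDeriv, (chartAt E2 c).right_inv hy.1, mink_comm] at h1
        exact h1) u
      rw [vn, hv.fderiv] at this
      simpa [coordDeriv] using this
    have hsym := cF.isSymmSndFDerivAt (by simpa using ENat.LEInfty.out)
    intro u v
    have h1 := hD u v
    rw [hsym.eq u v] at h1
    linarith [hD v u]

end Lifts

/-! ### Curvatures of immersed surfaces and of their parallel surfaces -/

theorem continuous_gram : Continuous fun P : (E2 →L[ℝ] V) × (E2 →L[ℝ] V) => gram P.1 P.2 := by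
  refine continuous_matrix fun i j => ?_
  simp only [gram_apply, mink]
  fun_prop

section Curvature

variable {Γ : Subgroup IsomH3} {S : Type*} [TopologicalSpace S] [ChartedSpace E2 S]

theorem contMDiffOn_comb {F n : S → V} {U : Set S} (hF : ContMDiffOn (𝓡 2) 𝓘(ℝ, V) ∞ F U)
    (hn : ContMDiffOn (𝓡 2) 𝓘(ℝ, V) ∞ n U) (a b : ℝ) :
    ContMDiffOn (𝓡 2) 𝓘(ℝ, V) ∞ (fun q => a • F q + b • n q) U := by
  have h : ContDiff ℝ ∞ fun P : V × V => a • P.1 + b • P.2 := by fun_prop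
  exact h.contMDiff.comp_contMDiffOn (hF.prodMk_space hn)

/-- The matrix `g⁻¹h` of the shape operator at `q` in the coordinates of the chart around `c`. -/
noncomputable def chartShape (ν : S → T1Mfd Γ) (c q : S) : Matrix (Fin 2) (Fin 2) ℝ :=
  (firstForm ν c q)⁻¹ * secondForm ν c q

/-- The Gauss–Kronecker curvature, the product of the principal curvatures. -/
noncomputable def extrinsicCurvature (ν : S → T1Mfd Γ) (p : S) : ℝ := (shape ν p).det

/-- The Jacobian determinant `det (cosh r + sinh r A)` of the normal flow from the surface with
shape operator `A` to its parallel surface at distance `r`. -/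
noncomputable def jacobian (ν : S → T1Mfd Γ) (r : ℝ) (p : S) : ℝ :=
  Real.cosh r ^ 2 + meanCurvature ν p * (Real.cosh r * Real.sinh r) +
    extrinsicCurvature ν p * Real.sinh r ^ 2

variable [IsManifold (𝓡 2) ∞ S] {f : S → Mfd Γ} {ν : S → T1Mfd Γ}

namespace IsImmersedSurface

theorem exists_frame (hf : IsImmersedSurface f ν) (p : S) : ∃ (U : Set S) (F n : S → V), p ∈ U ∧
    IsLocalLift ν U F n ∧ ∀ q ∈ U, ∀ c, q ∈ (chartAt E2 c).source →
      IsTangentFrame (F q) (n q) (coordDeriv F c q) (coordDeriv n c q) := by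
  obtain ⟨U, F, n, hp, h, hU⟩ := hf.exists_lift p
  exact ⟨U, F, n, hp, h, fun q hq c hc => isTangentFrame_of_lift h hU hq hc⟩

variable [LocallyCompactSpace S]

theorem det_firstForm_pos (hf : IsImmersedSurface f ν) (hΓ : IsManifoldGroup Γ) {c q : S}
    (hc : q ∈ (chartAt E2 c).source) : 0 < (firstForm ν c q).det := by
  obtain ⟨U, F, n, hq, h, hU⟩ := hf.exists_frame q
  rw [(forms_eq_gram hΓ h hq hc).1]
  exact (hU q hq c hc).det_gram_pos

theorem chartShape_trace_det (hf : IsImmersedSurface f ν) (hΓ : IsManifoldGroup Γ) {c q : S}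
    (hc : q ∈ (chartAt E2 c).source) : (chartShape ν c q).trace = meanCurvature ν q ∧
      (chartShape ν c q).det = extrinsicCurvature ν q := by
  obtain ⟨U, F, n, hq, h, hU⟩ := hf.exists_frame q
  have hqq := mem_chart_source E2 q
  have h0 := (hf.det_firstForm_pos hΓ hqq).ne'
  rw [meanCurvature, extrinsicCurvature, shape, chartShape]
  rw [(forms_eq_gram hΓ h hq hqq).1, coordDeriv_eq_comp h.isOpen h.smooth_point hq hc hqq,
    gram_comp] at h0
  rw [(forms_eq_gram hΓ h hq hqq).1, (forms_eq_gram hΓ h hq hqq).2,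
    (forms_eq_gram hΓ h hq hc).1, (forms_eq_gram hΓ h hq hc).2,
    coordDeriv_eq_comp h.isOpen h.smooth_point hq hc hqq,
    coordDeriv_eq_comp h.isOpen h.smooth_normal hq hc hqq, gram_comp, gram_comp]
  obtain ⟨h1, h2⟩ := trace_det_conj (h := gram (coordDeriv n c q) (coordDeriv F c q)) h0
  exact ⟨h1.symm, h2.symm⟩

theorem continuousAt_forms (hf : IsImmersedSurface f ν) (hΓ : IsManifoldGroup Γ) {c q : S}
    (hc : q ∈ (chartAt E2 c).source) :
    ContinuousAt (firstForm ν c) q ∧ ContinuousAt (secondForm ν c) q := by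
  obtain ⟨U, F, n, hq, h, -⟩ := hf.exists_lift q
  have hmem : U ∩ (chartAt E2 c).source ∈ 𝓝 q :=
    (h.isOpen.inter (chartAt E2 c).open_source).mem_nhds ⟨hq, hc⟩
  have cF := (continuousOn_coordDeriv h.isOpen h.smooth_point c).continuousAt hmem
  have cn := (continuousOn_coordDeriv h.isOpen h.smooth_normal c).continuousAt hmem
  constructor
  · refine ((continuous_gram.continuousAt (x := (coordDeriv F c q, coordDeriv F c q))).comp
      (f := fun q => (coordDeriv F c q, coordDeriv F c q)) (cF.prodMk cF)).congr ?_
    filter_upwards [hmem] with y hy using ((forms_eq_gram hΓ h hy.1 hy.2).1).symm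
  · refine ((continuous_gram.continuousAt (x := (coordDeriv n c q, coordDeriv F c q))).comp
      (f := fun q => (coordDeriv n c q, coordDeriv F c q)) (cn.prodMk cF)).congr ?_
    filter_upwards [hmem] with y hy using ((forms_eq_gram hΓ h hy.1 hy.2).2).symm

theorem continuousOn_sqrt_det (hf : IsImmersedSurface f ν) (hΓ : IsManifoldGroup Γ) (c : S) :
    ContinuousOn (fun x => √(firstForm ν c ((chartAt E2 c).symm x)).det)
      (chartAt E2 c).target := by
  have h1 : ContinuousOn (firstForm ν c) (chartAt E2 c).source := fun q hq =>
    (hf.continuousAt_forms hΓ hq).1.continuousWithinAt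
  have h2 := h1.comp (chartAt E2 c).continuousOn_symm fun x hx => (chartAt E2 c).map_target hx
  exact Real.continuous_sqrt.comp_continuousOn (continuous_id.matrix_det.comp_continuousOn h2)

theorem aemeasurable_density (hf : IsImmersedSurface f ν) (hΓ : IsManifoldGroup Γ) (c : S) :
    AEMeasurable (fun x => ENNReal.ofReal (√(firstForm ν c ((chartAt E2 c).symm x)).det))
      (volume.restrict (chartAt E2 c).target) :=
  ((hf.continuousOn_sqrt_det hΓ c).aemeasurable
    (chartAt E2 c).open_target.measurableSet).ennreal_ofReal

theorem continuousAt_chartShape (hf : IsImmersedSurface f ν) (hΓ : IsManifoldGroup Γ) {c q : S}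
    (hc : q ∈ (chartAt E2 c).source) : ContinuousAt (chartShape ν c) q := by
  obtain ⟨h1, h2⟩ := hf.continuousAt_forms hΓ hc
  have hdet : ContinuousAt (fun y => (firstForm ν c y).det) q :=
    (continuous_id.matrix_det.continuousAt).comp h1
  have hadj : ContinuousAt (fun y => (firstForm ν c y).adjugate) q :=
    (continuous_id.matrix_adjugate.continuousAt).comp h1
  have := ((hdet.inv₀ (hf.det_firstForm_pos hΓ hc).ne').smul hadj).mul h2
  refine this.congr (Filter.Eventually.of_forall fun y => ?_)
  simp [chartShape, Matrix.inv_def, Ring.inverse_eq_inv']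

theorem continuous_meanCurvature (hf : IsImmersedSurface f ν) (hΓ : IsManifoldGroup Γ) :
    Continuous (meanCurvature ν) := by
  refine continuous_iff_continuousAt.2 fun q => ?_
  have hq := mem_chart_source E2 q
  refine ((continuous_id.matrix_trace.continuousAt).comp
    (hf.continuousAt_chartShape hΓ hq)).congr ?_
  filter_upwards [(chartAt E2 q).open_source.mem_nhds hq] with y hy
    using (hf.chartShape_trace_det hΓ hy).1

theorem continuous_extrinsicCurvature (hf : IsImmersedSurface f ν) (hΓ : IsManifoldGroup Γ) :
    Continuous (extrinsicCurvature ν) := by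
  refine continuous_iff_continuousAt.2 fun q => ?_
  have hq := mem_chart_source E2 q
  refine ((continuous_id.matrix_det.continuousAt).comp
    (hf.continuousAt_chartShape hΓ hq)).congr ?_
  filter_upwards [(chartAt E2 q).open_source.mem_nhds hq] with y hy
    using (hf.chartShape_trace_det hΓ hy).2

theorem continuous_jacobian (hf : IsImmersedSurface f ν) (hΓ : IsManifoldGroup Γ) (r : ℝ) :
    Continuous (jacobian ν r) :=
  (continuous_const.add ((hf.continuous_meanCurvature hΓ).mul_const _)).add
    ((hf.continuous_extrinsicCurvature hΓ).mul_const _)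

theorem exists_principalCurvatures (hf : IsImmersedSurface f ν) (hΓ : IsManifoldGroup Γ) (p : S) :
    ∃ k : ℝ × ℝ, principalCurvatures ν p = {k.1, k.2} ∧ meanCurvature ν p = k.1 + k.2 ∧
      extrinsicCurvature ν p = k.1 * k.2 := by
  obtain ⟨U, F, n, hp, h, hU⟩ := hf.exists_frame p
  have hc := mem_chart_source E2 p
  obtain ⟨k, h1, h2⟩ := (hU p hp p hc).exists_eigenvalues
  rw [← (forms_eq_gram hΓ h hp hc).1, ← (forms_eq_gram hΓ h hp hc).2] at h1 h2
  exact ⟨k, charpoly_roots_eq h1 h2, h1, h2⟩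

theorem exists_small (hf : IsImmersedSurface f ν) (hΓ : IsManifoldGroup Γ)
    (hs : HasSmallCurvatures ν) (p : S) :
    ∃ k : ℝ × ℝ, (-1 < k.1 ∧ k.1 < 1) ∧ (-1 < k.2 ∧ k.2 < 1) ∧
      meanCurvature ν p = k.1 + k.2 ∧ extrinsicCurvature ν p = k.1 * k.2 := by
  obtain ⟨k, h1, h2, h3⟩ := hf.exists_principalCurvatures hΓ p
  exact ⟨k, hs p _ (by rw [h1]; simp), hs p _ (by rw [h1]; simp), h2, h3⟩

theorem jacobian_pos (hf : IsImmersedSurface f ν) (hΓ : IsManifoldGroup Γ)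
    (hs : HasSmallCurvatures ν) (r : ℝ) (p : S) : 0 < jacobian ν r p := by
  obtain ⟨k, h1, h2, h3, h4⟩ := hf.exists_small hΓ hs p
  have := mul_pos (cosh_add_mul_sinh_pos h1 r) (cosh_add_mul_sinh_pos h2 r)
  rw [jacobian, h3, h4]
  linarith

/-- Small curvatures give `|H| < 1 + K`. -/
theorem abs_meanCurvature_lt (hf : IsImmersedSurface f ν) (hΓ : IsManifoldGroup Γ)
    (hs : HasSmallCurvatures ν) (p : S) : |meanCurvature ν p| < 1 + extrinsicCurvature ν p := by
  obtain ⟨k, h1, h2, h3, h4⟩ := hf.exists_small hΓ hs p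
  rw [h3, h4, abs_lt]
  constructor <;> nlinarith

/-- A local lift of a surface with small curvatures gives one of its parallel surfaces, by the
geodesic flow of the hyperboloid model. -/
theorem exists_frame_parallel (hf : IsImmersedSurface f ν) (hΓ : IsManifoldGroup Γ)
    (hs : HasSmallCurvatures ν) (r : ℝ) (p : S) : ∃ (U : Set S) (F n F' n' : S → V), p ∈ U ∧
      IsLocalLift ν U F n ∧ IsLocalLift (parallelNormal ν r) U F' n' ∧
      ∀ q ∈ U, ∀ c, q ∈ (chartAt E2 c).source →
      IsTangentFrame (F q) (n q) (coordDeriv F c q) (coordDeriv n c q) ∧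
      IsTangentFrame (F' q) (n' q) (coordDeriv F' c q) (coordDeriv n' c q) ∧
      coordDeriv F' c q = Real.cosh r • coordDeriv F c q + Real.sinh r • coordDeriv n c q ∧
      coordDeriv n' c q = Real.sinh r • coordDeriv F c q + Real.cosh r • coordDeriv n c q ∧
      (Real.cosh r • 1 + Real.sinh r • ((gram (coordDeriv F c q) (coordDeriv F c q))⁻¹ *
        gram (coordDeriv n c q) (coordDeriv F c q))).det = jacobian ν r q := by
  obtain ⟨U, F, n, hp, h, hU⟩ := hf.exists_frame p
  refine ⟨U, F, n, fun q => Real.cosh r • F q + Real.sinh r • n q,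
    fun q => Real.sinh r • F q + Real.cosh r • n q, hp, h, ?_, ?_⟩
  · refine ⟨h.isOpen, ?_, ?_, fun q hq => ?_⟩
    · exact contMDiffOn_comb h.smooth_point h.smooth_normal _ _
    · exact contMDiffOn_comb h.smooth_point h.smooth_normal _ _
    · obtain ⟨hm, hq⟩ := h.lifts q hq
      refine ⟨flow_mem r hm, ?_⟩
      rw [parallelNormal, ← hq]
      rfl
  · intro q hq c hc
    have hfr := hU q hq c hc
    have e1 := coordDeriv_comb h.isOpen h.smooth_point h.smooth_normal hq hc
      (Real.cosh r) (Real.sinh r)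
    have e2 := coordDeriv_comb h.isOpen h.smooth_point h.smooth_normal hq hc
      (Real.sinh r) (Real.cosh r)
    have hdet : (Real.cosh r • 1 + Real.sinh r • ((gram (coordDeriv F c q) (coordDeriv F c q))⁻¹ *
        gram (coordDeriv n c q) (coordDeriv F c q))).det = jacobian ν r q := by
      obtain ⟨h1, h2⟩ := hf.chartShape_trace_det hΓ hc
      rw [chartShape, (forms_eq_gram hΓ h hq hc).1, (forms_eq_gram hΓ h hq hc).2] at h1 h2
      rw [det_smul_one_add_smul, h1, h2, jacobian]
    refine ⟨hfr, ?_, e1, e2, hdet⟩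
    rw [e1, e2]
    exact hfr.parallel r (hdet ▸ (hf.jacobian_pos hΓ hs r q).ne')

/-- With principal curvatures in `(-1, 1)`, the parallel surfaces are immersed. -/
theorem parallel (hf : IsImmersedSurface f ν) (hΓ : IsManifoldGroup Γ)
    (hs : HasSmallCurvatures ν) (r : ℝ) :
    IsImmersedSurface (parallelMap ν r) (parallelNormal ν r) where
  footpoint_eq _ := rfl
  exists_lift p := by
    obtain ⟨U, F, n, F', n', hp, -, h', hU⟩ := hf.exists_frame_parallel hΓ hs r p
    refine ⟨U, F', n', hp, h', fun q hq => ?_⟩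
    obtain ⟨-, hfr, -⟩ := hU q hq q (mem_chart_source E2 q)
    exact ⟨hfr.injective, hfr.deriv_normal⟩

theorem det_firstForm_parallel (hf : IsImmersedSurface f ν) (hΓ : IsManifoldGroup Γ)
    (hs : HasSmallCurvatures ν) (r : ℝ) {c q : S} (hc : q ∈ (chartAt E2 c).source) :
    (firstForm (parallelNormal ν r) c q).det = (firstForm ν c q).det * jacobian ν r q ^ 2 := by
  obtain ⟨U, F, n, F', n', hq, h, h', hU⟩ := hf.exists_frame_parallel hΓ hs r q
  obtain ⟨hfr, -, e1, -, hdet⟩ := hU q hq c hc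
  rw [(forms_eq_gram hΓ h' hq hc).1, (forms_eq_gram hΓ h hq hc).1, e1, hfr.gram_parallel,
    Matrix.det_mul, Matrix.det_mul, hdet, sq]

theorem shape_parallel (hf : IsImmersedSurface f ν) (hΓ : IsManifoldGroup Γ)
    (hs : HasSmallCurvatures ν) (r : ℝ) (q : S) :
    (Real.cosh r • 1 + Real.sinh r • shape ν q).det = jacobian ν r q ∧
    shape (parallelNormal ν r) q = (Real.cosh r • 1 + Real.sinh r • shape ν q)⁻¹ *
      (Real.sinh r • 1 + Real.cosh r • shape ν q) := by
  obtain ⟨U, F, n, F', n', hq, h, h', hU⟩ := hf.exists_frame_parallel hΓ hs r q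
  have hc := mem_chart_source E2 q
  obtain ⟨hfr, -, e1, e2, hdet⟩ := hU q hq q hc
  rw [shape, shape, (forms_eq_gram hΓ h' hq hc).1, (forms_eq_gram hΓ h' hq hc).2,
    (forms_eq_gram hΓ h hq hc).1, (forms_eq_gram hΓ h hq hc).2, e1, e2]
  exact ⟨hdet, hfr.shape_parallel r (hdet ▸ (hf.jacobian_pos hΓ hs r q).ne')⟩

/-- The mean curvature of the parallel surface, weighted with the area density, is the
`r`-derivative of the area density. -/
theorem jacobian_mul_meanCurvature_parallel (hf : IsImmersedSurface f ν) (hΓ : IsManifoldGroup Γ)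
    (hs : HasSmallCurvatures ν) (r : ℝ) (q : S) :
    jacobian ν r q * meanCurvature (parallelNormal ν r) q =
      (1 + extrinsicCurvature ν q) * Real.sinh (2 * r) + meanCurvature ν q * Real.cosh (2 * r) := by
  obtain ⟨h1, h2⟩ := hf.shape_parallel hΓ hs r q
  have h3 := (hf.jacobian_pos hΓ hs r q).ne'
  rw [← h1] at h3
  rw [← h1, meanCurvature, h2, det_mul_trace_inv_mul _ _ _ h3, Real.sinh_two_mul, Real.cosh_two_mul,
    meanCurvature, extrinsicCurvature]
  ring

theorem smallCurvatures_parallel (hf : IsImmersedSurface f ν) (hΓ : IsManifoldGroup Γ)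
    (hs : HasSmallCurvatures ν) (r : ℝ) : HasSmallCurvatures (parallelNormal ν r) := by
  intro q
  obtain ⟨k, hk1, hk2, ht, hd⟩ := hf.exists_small hΓ hs q
  obtain ⟨h1, h2⟩ := hf.shape_parallel hΓ hs r q
  have h3 := (hf.jacobian_pos hΓ hs r q).ne'
  have p1 := cosh_add_mul_sinh_pos hk1 r
  have p2 := cosh_add_mul_sinh_pos hk2 r
  have hJ : jacobian ν r q = (Real.cosh r + k.1 * Real.sinh r) *
      (Real.cosh r + k.2 * Real.sinh r) := by
    rw [jacobian, ht, hd]; ring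
  have hroots : principalCurvatures (parallelNormal ν r) q =
      {(Real.sinh r + k.1 * Real.cosh r) / (Real.cosh r + k.1 * Real.sinh r),
        (Real.sinh r + k.2 * Real.cosh r) / (Real.cosh r + k.2 * Real.sinh r)} := by
    apply charpoly_roots_eq
    · have h4 := hf.jacobian_mul_meanCurvature_parallel hΓ hs r q
      rw [← meanCurvature, eq_comm, div_add_div _ _ p1.ne' p2.ne', div_eq_iff (mul_pos p1 p2).ne',
        ← hJ, mul_comm (meanCurvature _ _), h4, Real.sinh_two_mul, Real.cosh_two_mul, ht, hd]
      ring
    · rw [h2, Matrix.det_mul, Matrix.det_nonsing_inv, Ring.inverse_eq_inv', h1, eq_comm,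
        div_mul_div_comm, ← hJ, div_eq_inv_mul]
      congr 1
      rw [det_smul_one_add_smul]
      rw [meanCurvature] at ht
      rw [extrinsicCurvature] at hd
      rw [ht, hd]
      ring
  intro k' hk'
  rw [hroots] at hk'
  simp only [Multiset.insert_eq_cons, Multiset.mem_cons, Multiset.mem_singleton] at hk'
  rcases hk' with rfl | rfl
  · exact parallel_curvature_mem hk1 r
  · exact parallel_curvature_mem hk2 r

end IsImmersedSurface

theorem geodesicFlow_add (a b : ℝ) (w : T1Mfd Γ) :
    geodesicFlow Γ b (geodesicFlow Γ a w) = geodesicFlow Γ (a + b) w := by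
  induction w using Quotient.inductionOn with
  | h z =>
    refine congrArg (Quotient.mk _) (Subtype.ext (Prod.ext ?_ ?_))
    · change Real.cosh b • (Real.cosh a • z.1.1 + Real.sinh a • z.1.2) +
        Real.sinh b • (Real.sinh a • z.1.1 + Real.cosh a • z.1.2) =
        Real.cosh (a + b) • z.1.1 + Real.sinh (a + b) • z.1.2
      rw [Real.cosh_add, Real.sinh_add]
      module
    · change Real.sinh b • (Real.cosh a • z.1.1 + Real.sinh a • z.1.2) +
        Real.cosh b • (Real.sinh a • z.1.1 + Real.cosh a • z.1.2) =
        Real.sinh (a + b) • z.1.1 + Real.cosh (a + b) • z.1.2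
      rw [Real.cosh_add, Real.sinh_add]
      module

end Curvature

/-! ### The area measure -/

theorem map_withDensity_comp {α β : Type*} [MeasurableSpace α] [MeasurableSpace β] {m : Measure α}
    {φ : α → β} (hφ : AEMeasurable φ m) {J : β → ENNReal} (hJ : Measurable J) :
    (m.withDensity (J ∘ φ)).map φ = (m.map φ).withDensity J := by
  have hφJ : AEMeasurable (J ∘ φ) m := hJ.comp_aemeasurable hφ
  refine Measure.ext_of_lintegral _ fun g hg => ?_
  rw [lintegral_map' hg.aemeasurable (hφ.mono_ac (withDensity_absolutelyContinuous _ _)),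
    lintegral_withDensity_eq_lintegral_mul _ hJ hg,
    lintegral_map' (hJ.mul hg).aemeasurable hφ,
    lintegral_withDensity_eq_lintegral_mul₀ hφJ (g := fun a => g (φ a)) (hg.comp_aemeasurable hφ)]
  rfl

theorem tsupport_chartPartition_subset {S : Type*} [TopologicalSpace S] [ChartedSpace E2 S]
    [CompactSpace S] [T2Space S] (c : S) :
    tsupport (chartPartition S c) ⊆ (chartAt E2 c).source :=
  Classical.choose_spec (exists_chartPartition S) c

section Area

variable {Γ : Subgroup IsomH3} {S : Type*} [TopologicalSpace S] [ChartedSpace E2 S]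
  [MeasurableSpace S] [BorelSpace S]

theorem aemeasurable_chart_symm (c : S) :
    AEMeasurable (chartAt E2 c).symm (volume.restrict (chartAt E2 c).target) :=
  (chartAt E2 c).continuousOn_symm.aemeasurable (chartAt E2 c).open_target.measurableSet

variable [IsManifold (𝓡 2) ∞ S] [CompactSpace S] [T2Space S]
  {f : S → Mfd Γ} {ν : S → T1Mfd Γ}

namespace IsImmersedSurface

/-- The normal flow multiplies the area measure by its Jacobian determinant. -/
theorem areaMeasure_parallel (hf : IsImmersedSurface f ν) (hΓ : IsManifoldGroup Γ)
    (hs : HasSmallCurvatures ν) (r : ℝ) : areaMeasure (parallelNormal ν r) =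
      (areaMeasure ν).withDensity fun p => ENNReal.ofReal (jacobian ν r p) := by
  have hJ : Measurable fun p => ENNReal.ofReal (jacobian ν r p) :=
    (hf.continuous_jacobian hΓ r).measurable.ennreal_ofReal
  have hchart : ∀ c, chartArea (parallelNormal ν r) c =
      (chartArea ν c).withDensity fun p => ENNReal.ofReal (jacobian ν r p) := by
    intro c
    have hD := hf.aemeasurable_density hΓ c
    have hφ := aemeasurable_chart_symm c
    have hJφ := hJ.comp_aemeasurable hφ
    rw [chartArea, chartArea, ← map_withDensity_comp
      (hφ.mono_ac (withDensity_absolutelyContinuous _ _)) hJ, ← withDensity_mul₀ hD hJφ]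
    congr 1
    refine withDensity_congr_ae ?_
    filter_upwards [ae_restrict_mem (chartAt E2 c).open_target.measurableSet] with x hx
    have hc := (chartAt E2 c).map_target hx
    rw [hf.det_firstForm_parallel hΓ hs r hc, Real.sqrt_mul (hf.det_firstForm_pos hΓ hc).le,
      Real.sqrt_sq (hf.jacobian_pos hΓ hs r _).le, ENNReal.ofReal_mul (Real.sqrt_nonneg _)]
    rfl
  rw [areaMeasure, areaMeasure, withDensity_sum]
  congr 1
  funext c
  have hρ : Measurable fun p => ENNReal.ofReal (chartPartition S c p) :=
    (chartPartition S c).continuous.measurable.ennreal_ofReal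
  rw [hchart, ← withDensity_mul _ hJ hρ, ← withDensity_mul _ hρ hJ, mul_comm]

/-- The area of the surface weighted with one function of the partition of unity, as an integral
over the coordinate domain. -/
theorem chartArea_withDensity_univ (hf : IsImmersedSurface f ν) (hΓ : IsManifoldGroup Γ) (c : S) :
    ((chartArea ν c).withDensity fun p => ENNReal.ofReal (chartPartition S c p)) Set.univ =
      ∫⁻ x in (chartAt E2 c).target,
        ENNReal.ofReal (√(firstForm ν c ((chartAt E2 c).symm x)).det) *
          ENNReal.ofReal (chartPartition S c ((chartAt E2 c).symm x)) := by
  have hρ : Measurable fun p => ENNReal.ofReal (chartPartition S c p) :=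
    (chartPartition S c).continuous.measurable.ennreal_ofReal
  have hφ := aemeasurable_chart_symm c
  rw [withDensity_apply _ MeasurableSet.univ, Measure.restrict_univ, chartArea,
    lintegral_map' hρ.aemeasurable (hφ.mono_ac (withDensity_absolutelyContinuous _ _)),
    lintegral_withDensity_eq_lintegral_mul₀ (hf.aemeasurable_density hΓ c)
      (g := fun x => ENNReal.ofReal (chartPartition S c ((chartAt E2 c).symm x)))
      (hρ.comp_aemeasurable hφ)]
  rfl

theorem area_ne_top (hf : IsImmersedSurface f ν) (hΓ : IsManifoldGroup Γ) : area ν ≠ ⊤ := by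
  have hfin := (chartPartition S).locallyFinite.finite_nonempty_of_compact
  rw [area, areaMeasure, Measure.sum_apply _ MeasurableSet.univ]
  rw [tsum_eq_sum (s := hfin.toFinset)]
  · refine ENNReal.sum_ne_top.2 fun c _ => ?_
    rw [hf.chartArea_withDensity_univ hΓ]
    -- The integrand is bounded and supported in the compact image of the support of the cutoff.
    set K := chartAt E2 c '' tsupport (chartPartition S c)
    have hKt : K ⊆ (chartAt E2 c).target := by
      rintro _ ⟨q, hq, rfl⟩
      exact (chartAt E2 c).map_source (tsupport_chartPartition_subset c hq)
    have hK : IsCompact K := (isClosed_tsupport _).isCompact.image_of_continuousOn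
      ((chartAt E2 c).continuousOn.mono (tsupport_chartPartition_subset c))
    have hc1 : ContinuousOn (fun x => √(firstForm ν c ((chartAt E2 c).symm x)).det) K :=
      (hf.continuousOn_sqrt_det hΓ c).mono hKt
    obtain ⟨C, hC⟩ := hK.bddAbove_image hc1
    have hle : ∀ x ∈ (chartAt E2 c).target,
        ENNReal.ofReal (√(firstForm ν c ((chartAt E2 c).symm x)).det) *
          ENNReal.ofReal (chartPartition S c ((chartAt E2 c).symm x)) ≤
        K.indicator (fun _ => ENNReal.ofReal C) x := by
      intro x hx
      by_cases hxK : x ∈ K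
      · rw [Set.indicator_of_mem hxK]
        calc _ ≤ ENNReal.ofReal C * 1 := by
              gcongr
              · exact hC ⟨x, hxK, rfl⟩
              · exact ENNReal.ofReal_le_one.2 ((chartPartition S).le_one c _)
          _ = _ := mul_one _
      · have h0 : chartPartition S c ((chartAt E2 c).symm x) = 0 := by
          by_contra hne
          exact hxK ⟨_, subset_tsupport _ hne, (chartAt E2 c).right_inv hx⟩
        simp [h0]
    refine ((setLIntegral_mono' (chartAt E2 c).open_target.measurableSet hle).trans_lt ?_).ne
    rw [lintegral_indicator_const hK.measurableSet]
    exact ENNReal.mul_lt_top ENNReal.ofReal_lt_top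
      ((Measure.restrict_apply_le _ _).trans_lt hK.measure_lt_top)
  · intro c hc
    have h0 : ∀ q, chartPartition S c q = 0 := by
      intro q
      by_contra hne
      exact hc (hfin.mem_toFinset.2 ⟨q, hne⟩)
    rw [hf.chartArea_withDensity_univ hΓ]
    simp [h0]

theorem area_ne_zero [Nonempty S] (hf : IsImmersedSurface f ν) (hΓ : IsManifoldGroup Γ) :
    area ν ≠ 0 := by
  intro h0
  obtain ⟨p⟩ := ‹Nonempty S›
  obtain ⟨c, hc⟩ := (chartPartition S).exists_pos (Set.mem_univ p)
  rw [area, areaMeasure, Measure.sum_apply _ MeasurableSet.univ, ENNReal.tsum_eq_zero] at h0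
  have hint := h0 c
  have hρ : Measurable fun p => ENNReal.ofReal (chartPartition S c p) :=
    (chartPartition S c).continuous.measurable.ennreal_ofReal
  have hmeas : AEMeasurable (fun x =>
      ENNReal.ofReal (√(firstForm ν c ((chartAt E2 c).symm x)).det) *
        ENNReal.ofReal (chartPartition S c ((chartAt E2 c).symm x)))
      (volume.restrict (chartAt E2 c).target) :=
    (hf.aemeasurable_density hΓ c).mul (hρ.comp_aemeasurable (aemeasurable_chart_symm c))
  rw [hf.chartArea_withDensity_univ hΓ, lintegral_eq_zero_iff' hmeas] at hint
  have hae := (ae_restrict_iff' (chartAt E2 c).open_target.measurableSet).1 hint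
  have hopen : IsOpen ((chartAt E2 c).target ∩ (chartAt E2 c).symm ⁻¹'
      {q | 0 < chartPartition S c q}) :=
    (chartAt E2 c).isOpen_inter_preimage_symm
      (isOpen_lt continuous_const (chartPartition S c).continuous)
  have hpc : p ∈ (chartAt E2 c).source :=
    tsupport_chartPartition_subset c (subset_tsupport _ hc.ne')
  refine (hopen.measure_pos volume ⟨chartAt E2 c p, (chartAt E2 c).map_source hpc, ?_⟩).ne' ?_
  · simpa [(chartAt E2 c).left_inv hpc] using hc
  · refine measure_mono_null ?_ hae
    rintro x ⟨hx, hρx⟩ hcon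
    have h1 := hcon hx
    have h2 := hf.det_firstForm_pos hΓ ((chartAt E2 c).map_target hx)
    have h3 : 0 < √(firstForm ν c ((chartAt E2 c).symm x)).det := Real.sqrt_pos.2 h2
    simp only [Pi.zero_apply, mul_eq_zero, ENNReal.ofReal_eq_zero] at h1
    rcases h1 with h1 | h1
    · exact absurd h3 h1.not_gt
    · exact absurd hρx h1.not_gt

theorem isFiniteMeasure (hf : IsImmersedSurface f ν) (hΓ : IsManifoldGroup Γ) :
    IsFiniteMeasure (areaMeasure ν) :=
  ⟨(hf.area_ne_top hΓ).lt_top⟩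

theorem integrable (hf : IsImmersedSurface f ν) (hΓ : IsManifoldGroup Γ) {φ : S → ℝ}
    (hφ : Continuous φ) : Integrable φ (areaMeasure ν) :=
  have := hf.isFiniteMeasure hΓ
  hφ.integrable_of_hasCompactSupport (HasCompactSupport.of_compactSpace φ)

theorem averageMeanCurvature_eq_zero_iff [Nonempty S] (hf : IsImmersedSurface f ν)
    (hΓ : IsManifoldGroup Γ) :
    averageMeanCurvature ν = 0 ↔ ∫ p, meanCurvature ν p ∂(areaMeasure ν) = 0 := by
  have h : (areaMeasure ν).real Set.univ ≠ 0 :=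
    (ENNReal.toReal_pos (hf.area_ne_zero hΓ) (hf.area_ne_top hΓ)).ne'
  rw [averageMeanCurvature, average_eq, smul_eq_mul, mul_eq_zero, inv_eq_zero]
  exact or_iff_right h

/-! ### First variation and area of the parallel surfaces -/

theorem area_parallel (hf : IsImmersedSurface f ν) (hΓ : IsManifoldGroup Γ)
    (hs : HasSmallCurvatures ν) (r : ℝ) :
    area (parallelNormal ν r) = ENNReal.ofReal (∫ p, jacobian ν r p ∂(areaMeasure ν)) := by
  rw [area, hf.areaMeasure_parallel hΓ hs, withDensity_apply _ MeasurableSet.univ,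
    Measure.restrict_univ, ofReal_integral_eq_lintegral_ofReal
      (hf.integrable hΓ (hf.continuous_jacobian hΓ r))
      (Filter.Eventually.of_forall fun p => (hf.jacobian_pos hΓ hs r p).le)]

theorem integral_meanCurvature_parallel (hf : IsImmersedSurface f ν) (hΓ : IsManifoldGroup Γ)
    (hs : HasSmallCurvatures ν) (r : ℝ) :
    ∫ p, meanCurvature (parallelNormal ν r) p ∂(areaMeasure (parallelNormal ν r)) =
      (∫ p, (1 + extrinsicCurvature ν p) ∂(areaMeasure ν)) * Real.sinh (2 * r) +
        (∫ p, meanCurvature ν p ∂(areaMeasure ν)) * Real.cosh (2 * r) := by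
  have hH := hf.integrable hΓ (hf.continuous_meanCurvature hΓ)
  have hK := hf.integrable hΓ (φ := fun p => 1 + extrinsicCurvature ν p) 
    (continuous_const.add (hf.continuous_extrinsicCurvature hΓ))
  rw [hf.areaMeasure_parallel hΓ hs, integral_withDensity_eq_integral_toReal_smul
    (hf.continuous_jacobian hΓ r).measurable.ennreal_ofReal
    (Filter.Eventually.of_forall fun p => ENNReal.ofReal_lt_top),
    ← integral_mul_const, ← integral_mul_const, ← integral_add (hK.mul_const _) (hH.mul_const _)]
  refine integral_congr_ae (Filter.Eventually.of_forall fun p => ?_)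
  simp only [smul_eq_mul]
  rw [ENNReal.toReal_ofReal (hf.jacobian_pos hΓ hs r p).le,
    hf.jacobian_mul_meanCurvature_parallel hΓ hs]

theorem abs_integral_meanCurvature_lt [Nonempty S] (hf : IsImmersedSurface f ν)
    (hΓ : IsManifoldGroup Γ) (hs : HasSmallCurvatures ν) :
    |∫ p, meanCurvature ν p ∂(areaMeasure ν)| <
      ∫ p, (1 + extrinsicCurvature ν p) ∂(areaMeasure ν) := by
  have hH := hf.integrable hΓ (hf.continuous_meanCurvature hΓ)
  have hK := hf.integrable hΓ (φ := fun p => 1 + extrinsicCurvature ν p) 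
    (continuous_const.add (hf.continuous_extrinsicCurvature hΓ))
  refine abs_integral_le_integral_abs.trans_lt ?_
  rw [← sub_pos, ← integral_sub hK hH.abs, integral_pos_iff_support_of_nonneg
    (fun p => sub_nonneg.2 (hf.abs_meanCurvature_lt hΓ hs p).le) (hK.sub hH.abs)]
  have : Function.support (fun p => 1 + extrinsicCurvature ν p - |meanCurvature ν p|) =
      Set.univ :=
    Set.eq_univ_of_forall fun p => (sub_pos.2 (hf.abs_meanCurvature_lt hΓ hs p)).ne'
  rw [this]
  exact pos_iff_ne_zero.2 (hf.area_ne_zero hΓ)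

end IsImmersedSurface

end Area

theorem existsUnique_mul_sinh_add_mul_cosh_eq_zero {a b : ℝ} (h : |b| < a) :
    ∃! r : ℝ, a * Real.sinh (2 * r) + b * Real.cosh (2 * r) = 0 := by
  obtain ⟨h1, h2⟩ := abs_lt.1 h
  have hp : 0 < a + b := by linarith
  have hm : 0 < a - b := by linarith
  have key : ∀ r : ℝ, a * Real.sinh (2 * r) + b * Real.cosh (2 * r) = 0 ↔
      r = (Real.log (a - b) - Real.log (a + b)) / 4 := by
    intro r
    have e1 : a * Real.sinh (2 * r) + b * Real.cosh (2 * r) =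
        ((a + b) * Real.exp (2 * r) - (a - b) * Real.exp (-(2 * r))) / 2 := by
      rw [Real.sinh_eq, Real.cosh_eq]; ring
    have e2 : (a + b) * Real.exp (2 * r) = Real.exp (Real.log (a + b) + 2 * r) := by
      rw [Real.exp_add, Real.exp_log hp]
    have e3 : (a - b) * Real.exp (-(2 * r)) = Real.exp (Real.log (a - b) + -(2 * r)) := by
      rw [Real.exp_add, Real.exp_log hm]
    rw [e1, div_eq_zero_iff, or_iff_left (by norm_num), sub_eq_zero, e2, e3, Real.exp_eq_exp]
    constructor <;> intro h <;> linarith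
  exact ⟨_, (key _).2 rfl, fun r hr => (key r).1 hr⟩

section MinimalArea

variable {Γ : Subgroup IsomH3} {S : Type*} [TopologicalSpace S] [ChartedSpace E2 S]
  [IsManifold (𝓡 2) ∞ S] [CompactSpace S] [T2Space S] [MeasurableSpace S] [BorelSpace S]
  {f : S → Mfd Γ} {ν : S → T1Mfd Γ}

namespace IsImmersedSurface

/-- If the total mean curvature vanishes, the term `H cosh r sinh r` does not contribute to the
area of the parallel surface. -/
theorem area_parallel_of_integral_eq_zero (hf : IsImmersedSurface f ν) (hΓ : IsManifoldGroup Γ)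
    (hs : HasSmallCurvatures ν) (h0 : ∫ p, meanCurvature ν p ∂(areaMeasure ν) = 0) (r : ℝ) :
    area (parallelNormal ν r) = ENNReal.ofReal (∫ p, (Real.cosh r ^ 2 +
      extrinsicCurvature ν p * Real.sinh r ^ 2) ∂(areaMeasure ν)) := by
  have hH := (hf.integrable hΓ (hf.continuous_meanCurvature hΓ)).mul_const
    (Real.cosh r * Real.sinh r)
  have hK := hf.integrable hΓ (φ := fun p => Real.cosh r ^ 2 +
    extrinsicCurvature ν p * Real.sinh r ^ 2)
    (continuous_const.add ((hf.continuous_extrinsicCurvature hΓ).mul_const _))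
  rw [hf.area_parallel hΓ hs]
  have : ∀ p, jacobian ν r p = (Real.cosh r ^ 2 + extrinsicCurvature ν p * Real.sinh r ^ 2) +
      meanCurvature ν p * (Real.cosh r * Real.sinh r) := fun p => by rw [jacobian]; ring
  simp only [this]
  rw [integral_add hK hH, integral_mul_const, h0, zero_mul, add_zero]

theorem area_parallel_lt [Nonempty S] (hf : IsImmersedSurface f ν) (hΓ : IsManifoldGroup Γ)
    (hs : HasSmallCurvatures ν) (h0 : ∫ p, meanCurvature ν p ∂(areaMeasure ν) = 0) {r r' : ℝ}
    (hr : |r| < |r'|) : area (parallelNormal ν r) < area (parallelNormal ν r') := by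
  have := hf.isFiniteMeasure hΓ
  have hK := hf.integrable hΓ (continuous_const.add (hf.continuous_extrinsicCurvature hΓ))
    (φ := fun p => 1 + extrinsicCurvature ν p)
  have hpos : 0 < ∫ p, (1 + extrinsicCurvature ν p) ∂(areaMeasure ν) :=
    (abs_nonneg _).trans_lt (hf.abs_integral_meanCurvature_lt hΓ hs)
  have hint : ∀ s : ℝ, ∫ p, (Real.cosh s ^ 2 +
      extrinsicCurvature ν p * Real.sinh s ^ 2) ∂(areaMeasure ν) =
      (areaMeasure ν).real Set.univ +
        (∫ p, (1 + extrinsicCurvature ν p) ∂(areaMeasure ν)) * Real.sinh s ^ 2 := by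
    intro s
    have : ∀ p, Real.cosh s ^ 2 + extrinsicCurvature ν p * Real.sinh s ^ 2 =
        1 + (1 + extrinsicCurvature ν p) * Real.sinh s ^ 2 := fun p => by
      rw [Real.cosh_sq]; ring
    simp only [this]
    rw [integral_add (integrable_const _) (hK.mul_const _), integral_mul_const, integral_const]
    simp
  have hsinh : Real.sinh r ^ 2 < Real.sinh r' ^ 2 := by
    rw [sq_lt_sq, Real.abs_sinh, Real.abs_sinh]
    exact Real.sinh_lt_sinh.2 hr
  rw [hf.area_parallel_of_integral_eq_zero hΓ hs h0, hf.area_parallel_of_integral_eq_zero hΓ hs h0,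
    hint, hint]
  refine (ENNReal.ofReal_lt_ofReal_iff_of_nonneg ?_).2 ?_
  · positivity
  · gcongr

end IsImmersedSurface
end MinimalArea

end Hyp

theorem proposition3p3 (Γ : Subgroup Hyp.IsomH3) (hΓ : Hyp.IsManifoldGroup Γ)
    {S : Type*} [TopologicalSpace S] [ChartedSpace Hyp.E2 S] [IsManifold (𝓡 2) ∞ S]
    [CompactSpace S] [T2Space S] [Nonempty S] [MeasurableSpace S] [BorelSpace S]
    (f : S → Hyp.Mfd Γ) (ν : S → Hyp.T1Mfd Γ) (hf : Hyp.IsImmersedSurface f ν)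
    (hsmall : Hyp.HasSmallCurvatures ν) :
    (∀ r : ℝ, Hyp.IsImmersedSurface (Hyp.parallelMap ν r) (Hyp.parallelNormal ν r) ∧
      Hyp.area (Hyp.parallelNormal ν r) ≠ ⊤ ∧
      Integrable (Hyp.meanCurvature (Hyp.parallelNormal ν r))
        (Hyp.areaMeasure (Hyp.parallelNormal ν r))) ∧
    (∃! r₀ : ℝ, Hyp.averageMeanCurvature (Hyp.parallelNormal ν r₀) = 0) ∧
    ∀ r₀ : ℝ, Hyp.averageMeanCurvature (Hyp.parallelNormal ν r₀) = 0 →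
      (∀ r : ℝ, r ≠ r₀ → Hyp.area (Hyp.parallelNormal ν r₀) < Hyp.area (Hyp.parallelNormal ν r)) ∧
      (∃ k₁ k₂ : S → ℝ,
        (∀ p, Hyp.principalCurvatures (Hyp.parallelNormal ν r₀) p = {k₁ p, k₂ p}) ∧
        ∀ r : ℝ,
          Integrable
            (fun p => Real.cosh (r - r₀) ^ 2 + k₁ p * k₂ p * Real.sinh (r - r₀) ^ 2)
            (Hyp.areaMeasure (Hyp.parallelNormal ν r₀)) ∧
          Hyp.area (Hyp.parallelNormal ν r) = ENNReal.ofReal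
            (∫ p, (Real.cosh (r - r₀) ^ 2 + k₁ p * k₂ p * Real.sinh (r - r₀) ^ 2)
              ∂(Hyp.areaMeasure (Hyp.parallelNormal ν r₀)))) ∧
      ∀ r r' : ℝ, |r - r₀| < |r' - r₀| →
        Hyp.area (Hyp.parallelNormal ν r) < Hyp.area (Hyp.parallelNormal ν r') := by
  have hpar := hf.parallel hΓ hsmall
  refine ⟨fun r => ⟨hpar r, (hpar r).area_ne_top hΓ,
    (hpar r).integrable hΓ ((hpar r).continuous_meanCurvature hΓ)⟩, ?_, fun r₀ hr₀ => ?_⟩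
  · simp only [((hpar _).averageMeanCurvature_eq_zero_iff hΓ),
      hf.integral_meanCurvature_parallel hΓ hsmall]
    exact Hyp.existsUnique_mul_sinh_add_mul_cosh_eq_zero
      (hf.abs_integral_meanCurvature_lt hΓ hsmall)
  · rw [(hpar r₀).averageMeanCurvature_eq_zero_iff hΓ] at hr₀
    have hs₀ := hf.smallCurvatures_parallel hΓ hsmall r₀
    -- Every parallel surface of `S` is a parallel surface of `S(r₀)`.
    have hflow : ∀ r, Hyp.parallelNormal ν r =
        Hyp.parallelNormal (Hyp.parallelNormal ν r₀) (r - r₀) := fun r => funext fun p => by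
      rw [Hyp.parallelNormal, Hyp.parallelNormal, Hyp.parallelNormal, Hyp.geodesicFlow_add,
        add_sub_cancel]
    have hmono : ∀ r r' : ℝ, |r - r₀| < |r' - r₀| →
        Hyp.area (Hyp.parallelNormal ν r) < Hyp.area (Hyp.parallelNormal ν r') := by
      intro r r' hr
      rw [hflow r, hflow r']
      exact (hpar r₀).area_parallel_lt hΓ hs₀ hr₀ hr
    refine ⟨fun r hr => hmono _ _ ?_, ?_, hmono⟩
    · rw [sub_self, abs_zero]
      exact abs_pos.2 (sub_ne_zero.2 hr)
    · choose k hk using (hpar r₀).exists_principalCurvatures hΓ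
      refine ⟨fun p => (k p).1, fun p => (k p).2, fun p => (hk p).1, fun r => ?_⟩
      simp only [← fun p => (hk p).2.2]
      refine ⟨(hpar r₀).integrable hΓ (continuous_const.add
        (((hpar r₀).continuous_extrinsicCurvature hΓ).mul_const _)), ?_⟩
      rw [hflow r]
      exact (hpar r₀).area_parallel_of_integral_eq_zero hΓ hs₀ hr₀ _
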